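/- For an integer $N\ge 1$ let $V=\{0,1\}^{2N}$ be the $2N$-dimensional hypercube; write $|x|$ for the number of coordinates of $x\in V$ equal to $1$, and $x\sim y$ if $x$ and $y$ differ in exactly one coordinate. For $\delta\in(-1,1)$ let $K_\delta$ be the Markov kernel on $V$ given by $$K_\delta(x,y)=\begin{cases}\frac1{2N} & \text{if } x\sim y,\ |x|\ne N,\\ \frac{1+\delta}{2N} & \text{if } x\sim y,\ |x|=N,\ |y|=N+1,\\ \frac{1-\delta}{2N} & \text{if } x\sim y,\ |x|=N,\ |y|=N-1,\\ 0&\text{otherwise,}\end{cases}$$ let $Q_\delta=\frac12(I+K_\delta)$ be its lazy version, and for $\varepsilon\in(0,1)$ put $\overline{\mathcal Q}(\varepsilon)=\{Q_\delta:\delta\in[-\varepsilon,\varepsilon]\}$. For a sequence $(K_i)_{i\ge1}$ of kernels on $V$ write $K_{0,n}=K_1K_2\cdots K_n$ (with $K_{0,0}=I$), and let $$T_{\mathrm{TV}}(\eta)=\inf\Bigl\{n\ge 0:\max_{x,y\in V}\|K_{0,n}(x,\cdot)-K_{0,n}(y,\cdot)\|_{\mathrm{TV}}<\eta\Bigr\},\qquad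 \|\mu-\nu\|_{\mathrm{TV}}=\sup_{A\subset V}\{\mu(A)-\nu(A)\},$$ with $\inf\emptyset=\infty$. Write $\log_+u=\max\{0,\log u\}$, and use the conventions $0/0=1$ and $a/0=\infty$ for $a>0$. **Theorem.** For every $\varepsilon\in(0,1)$ there is a constant $D(\varepsilon)>0$, depending only on $\varepsilon$, such that for every $N\ge2$, every sequence $(K_i)_{i\ge1}$ with $K_i\in\overline{\mathcal Q}(\varepsilon)$ for all $i\ge1$, and every $\eta>0$, $$T_{\mathrm{TV}}(\eta)\le D(\varepsilon)\,N\Bigl(\log N+\log_+\frac1\eta\Bigr),$$ and $$\max_{x,y,z\in V}\left|\frac{K_{0,n}(x,z)}{K_{0,n}(y,z)}-1\right|\le\eta\qquad\text{for all } n\ge D(\varepsilon)\,N\Bigl(\log N+\log_+\frac1\eta\Bigr).$$ -/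

import Mathlib

open scoped ENNReal

noncomputable section

namespace InhomMerging

section General

variable {V : Type*} [Fintype V] [DecidableEq V]

/-- `K_{0,n} = K_1 K_2 ⋯ K_n` (with `K_{0,0} = I`) for a sequence `(K_i)_{i ≥ 1}` of kernels,
written as matrices indexed by `V`. The entry `K 0` is never used. -/
def compKernel (K : ℕ → Matrix V V ℝ) : ℕ → Matrix V V ℝ
  | 0 => 1
  | n + 1 => compKernel K n * K (n + 1)

/-- Total variation distance `sup_{A ⊆ V} (μ(A) - ν(A))`
(a supremum over a finite nonempty family). -/
def tvDist (μ ν : V → ℝ) : ℝ :=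
  ⨆ A : Finset V, ((∑ z ∈ A, μ z) - ∑ z ∈ A, ν z)

/-- `max_{x,y} ‖K_{0,n}(x,·) - K_{0,n}(y,·)‖_TV`. -/
def maxTV (K : ℕ → Matrix V V ℝ) (n : ℕ) : ℝ :=
  ⨆ p : V × V, tvDist (compKernel K n p.1) (compKernel K n p.2)

/-- The max total variation merging time
`T_TV(η) = inf {n : max_{x,y} ‖K_{0,n}(x,·) - K_{0,n}(y,·)‖_TV < η}`, with `inf ∅ = ∞`. -/
def tvMergingTime (K : ℕ → Matrix V V ℝ) (η : ℝ) : ℕ∞ :=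
  ⨅ (n : ℕ) (_ : maxTV K n < η), (n : ℕ∞)

/-- `|a / b - 1|` for `a, b ≥ 0`, with the conventions `0 / 0 = 1` and `a / 0 = ∞` for `a > 0`. -/
def relDev (a b : ℝ) : ℝ≥0∞ :=
  if b = 0 then (if a = 0 then 0 else ⊤) else ENNReal.ofReal |a / b - 1|

/-- `max_{x,y,z} |K_{0,n}(x,z) / K_{0,n}(y,z) - 1|`. -/
def maxRelDev (K : ℕ → Matrix V V ℝ) (n : ℕ) : ℝ≥0∞ :=
  ⨆ (x : V) (y : V) (z : V), relDev (compKernel K n x z) (compKernel K n y z)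

end General

/-- The `2N`-dimensional hypercube `{0,1}^{2N}`. -/
abbrev Cube (N : ℕ) : Type := Fin (2 * N) → Fin 2

/-- `|x|`, the number of coordinates of `x` equal to `1`. -/
def weight {N : ℕ} (x : Cube N) : ℕ := ∑ i, (x i : ℕ)

/-- `K_δ`: simple random walk on the hypercube with a drift `δ` on the middle level `|x| = N`.
Two vertices are neighbours when they differ in exactly one coordinate. -/
def driftKernel (N : ℕ) (δ : ℝ) : Matrix (Cube N) (Cube N) ℝ := fun x y =>
  if hammingDist x y = 1 then
    if weight x ≠ N then 1 / (2 * (N : ℝ))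
    else if weight y = N + 1 then (1 + δ) / (2 * (N : ℝ))
    else (1 - δ) / (2 * (N : ℝ))
  else 0

/-- The lazy kernel `Q_δ = (I + K_δ) / 2`. -/
def lazyDriftKernel (N : ℕ) (δ : ℝ) : Matrix (Cube N) (Cube N) ℝ :=
  (1 / 2 : ℝ) • (1 + driftKernel N δ)

/-- The family `{Q_δ : δ ∈ [-ε, ε]}`. -/
def lazyFamily (N : ℕ) (ε : ℝ) : Set (Matrix (Cube N) (Cube N) ℝ) :=
  lazyDriftKernel N '' Set.Icc (-ε) ε

end InhomMerging

end

namespace InhomMerging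

open Finset Matrix Equiv

/-! The densities `4 ^ N * K_{0,n}(x, ·)` are controlled first on the middle level, uniformly over
the drifts, and then off it by a comparison principle.

On the middle level, two symmetries survive every choice of drifts. Functions of the level that are
invariant under exchanging 0 and 1 do not see the drift, so the mass of the middle level is that of
simple random walk, known from Walsh functions (`IsEvenLevel.driftProd_mulVec`). The kernels also
commute with coordinate permutations, so functions antisymmetric in `j` disjoint pairs of
coordinates stay so, and they decay like `θ ^ j` with `θ = exp (-n / (2N))`
(`IsAntisymm.abs_driftProd_mulVec_le`). A point mass on the middle level is the indicator of the
level times a product of coordinates. Exchanging one coordinate at a time against the remaining ones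
rewrites it as a constant times the indicator plus antisymmetric corrections
(`IsPairFunction.abs_driftProd_mulVec_sub_le`). Hence the mass is almost equidistributed on the
level, with a polynomial loss in `N` that the `log N` in the time absorbs.

Off the middle level the density evolves by the simple walk, with middle values times `coef` as
boundary data. The distance to the middle level is there an eigenfunction with eigenvalue `1 -
1/(2N)`, so it yields supersolutions showing that the initial data are forgotten
(`le_of_supersolution`). The density need not approach 1, but the densities from two starting points
merge and stay bounded below by a multiple of `1 - ε`, which gives relative merging and then total
variation merging. -/

variable {N : ℕ}

/-! ### The kernels as weighted coordinate flips -/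

/-- The vertex obtained from `x` by changing coordinate `i`. -/
def flipAt (i : Fin (2 * N)) (x : Cube N) : Cube N := Function.update x i (x i + 1)

/-- The `i`-th coordinate of `x` as a real number. -/
def bit (x : Cube N) (i : Fin (2 * N)) : ℝ := ((x i : ℕ) : ℝ)

/-- The relative weight which the walk with drift `δ` gives to flipping coordinate `i` of `x`. -/
noncomputable def coef (δ : ℝ) (x : Cube N) (i : Fin (2 * N)) : ℝ :=
  if weight x = N then 1 + δ * (1 - 2 * bit x i) else 1

theorem fin_two_add_one_add_one (a : Fin 2) : a + 1 + 1 = a := by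
  revert a; decide

theorem bit_eq_zero_or_one (x : Cube N) (i : Fin (2 * N)) : bit x i = 0 ∨ bit x i = 1 := by
  unfold bit
  generalize x i = a
  fin_cases a <;> simp

theorem flipAt_flipAt (i : Fin (2 * N)) (x : Cube N) : flipAt i (flipAt i x) = x := by
  simp [flipAt, fin_two_add_one_add_one]

theorem flipAt_apply_self (i : Fin (2 * N)) (x : Cube N) : flipAt i x i = x i + 1 := by
  simp [flipAt]

theorem flipAt_apply_of_ne {i j : Fin (2 * N)} (h : j ≠ i) (x : Cube N) :
    flipAt i x j = x j := by
  simp [flipAt, h]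

theorem bit_flipAt_self (i : Fin (2 * N)) (x : Cube N) : bit (flipAt i x) i = 1 - bit x i := by
  unfold bit
  rw [flipAt_apply_self]
  generalize x i = a
  fin_cases a <;> simp

theorem bit_flipAt_of_ne {i j : Fin (2 * N)} (h : j ≠ i) (x : Cube N) :
    bit (flipAt i x) j = bit x j := by
  unfold bit
  rw [flipAt_apply_of_ne h]

theorem weight_eq_sum_bit (x : Cube N) : (weight x : ℝ) = ∑ i, bit x i := by
  simp [weight, bit]

theorem weight_flipAt (i : Fin (2 * N)) (x : Cube N) :
    (weight (flipAt i x) : ℝ) = weight x + (1 - 2 * bit x i) := by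
  rw [weight_eq_sum_bit, weight_eq_sum_bit, ← add_sum_erase _ _ (mem_univ i),
    ← add_sum_erase univ (bit x) (mem_univ i), bit_flipAt_self,
    sum_congr rfl fun j hj => bit_flipAt_of_ne (ne_of_mem_erase hj) x]
  ring

theorem hammingDist_flipAt (i : Fin (2 * N)) (x : Cube N) : hammingDist x (flipAt i x) = 1 := by
  have : (univ.filter fun j => x j ≠ flipAt i x j) = {i} := by
    ext j
    by_cases h : j = i
    · subst h
      simp [flipAt_apply_self]
    · simp [flipAt_apply_of_ne h, h]
  rw [hammingDist, this, card_singleton]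

theorem exists_eq_flipAt {x y : Cube N} (h : hammingDist x y = 1) : ∃ i, flipAt i x = y := by
  obtain ⟨i, hi⟩ := card_eq_one.1 h
  refine ⟨i, funext fun j => ?_⟩
  have hj : x j ≠ y j ↔ j = i := by
    have := congrArg (j ∈ ·) hi
    simpa using this
  by_cases h : j = i
  · subst h
    rw [flipAt_apply_self]
    have := hj.2 rfl
    revert this
    generalize x j = a
    generalize y j = b
    revert a b
    decide
  · rw [flipAt_apply_of_ne h]
    by_contra hne
    exact h (hj.1 hne)

theorem flipAt_injective (x : Cube N) : Function.Injective fun i => flipAt i x := by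
  intro i j h
  by_contra hne
  have h1 := congrFun h i
  simp only [flipAt_apply_self, flipAt_apply_of_ne hne] at h1
  revert h1
  generalize x i = a
  revert a
  decide

theorem sum_neighbours (x : Cube N) (φ : Cube N → ℝ) (h : ∀ y, hammingDist x y ≠ 1 → φ y = 0) :
    ∑ y, φ y = ∑ i, φ (flipAt i x) := by
  rw [← sum_image (f := φ) (flipAt_injective x).injOn]
  symm
  refine sum_subset (subset_univ _) fun y _ hy => h y fun hxy => hy ?_
  obtain ⟨i, rfl⟩ := exists_eq_flipAt hxy
  exact mem_image_of_mem _ (mem_univ i)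

theorem driftKernel_flipAt (δ : ℝ) (i : Fin (2 * N)) (x : Cube N) :
    driftKernel N δ x (flipAt i x) = coef δ x i / (2 * N) := by
  unfold driftKernel coef
  rw [if_pos (hammingDist_flipAt i x)]
  have hw := weight_flipAt i x
  by_cases h : weight x = N
  · rcases bit_eq_zero_or_one x i with hb | hb <;> rw [hb] at hw
    · have : weight (flipAt i x) = N + 1 := by
        rw [h] at hw; norm_num at hw; exact_mod_cast hw
      simp [h, this, hb]
    · have : weight (flipAt i x) ≠ N + 1 := by
        intro h'
        rw [h, h'] at hw; push_cast at hw; linarith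
      simp only [h, this, hb]
      norm_num
      ring
  · simp [h]

theorem sum_driftKernel_mul (δ : ℝ) (f : Cube N → ℝ) (x : Cube N) :
    ∑ y, driftKernel N δ x y * f y = 1 / (2 * N) * ∑ i, coef δ x i * f (flipAt i x) := by
  rw [sum_neighbours x fun y => driftKernel N δ x y * f y, mul_sum]
  · refine sum_congr rfl fun i _ => ?_
    rw [driftKernel_flipAt]; ring
  · intro y hy
    simp [driftKernel, hy]

theorem sum_mul_driftKernel (δ : ℝ) (f : Cube N → ℝ) (z : Cube N) :
    ∑ y, f y * driftKernel N δ y z =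
      1 / (2 * N) * ∑ i, coef δ (flipAt i z) i * f (flipAt i z) := by
  rw [sum_neighbours z fun y => f y * driftKernel N δ y z, mul_sum]
  · refine sum_congr rfl fun i _ => ?_
    have := driftKernel_flipAt δ i (flipAt i z)
    rw [flipAt_flipAt] at this
    rw [this]; ring
  · intro y hy
    rw [hammingDist_comm] at hy
    simp [driftKernel, hy]

theorem lazyDriftKernel_mulVec (δ : ℝ) (f : Cube N → ℝ) (x : Cube N) :
    (lazyDriftKernel N δ *ᵥ f) x =
      1 / 2 * f x + 1 / (4 * N) * ∑ i, coef δ x i * f (flipAt i x) := by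
  rw [lazyDriftKernel, smul_mulVec, add_mulVec, one_mulVec, Pi.smul_apply, Pi.add_apply,
    mulVec, dotProduct, sum_driftKernel_mul, smul_eq_mul]
  ring

theorem vecMul_lazyDriftKernel (δ : ℝ) (f : Cube N → ℝ) (z : Cube N) :
    (f ᵥ* lazyDriftKernel N δ) z =
      1 / 2 * f z + 1 / (4 * N) * ∑ i, coef δ (flipAt i z) i * f (flipAt i z) := by
  rw [lazyDriftKernel, vecMul_smul, vecMul_add, vecMul_one, Pi.smul_apply, Pi.add_apply,
    vecMul, dotProduct, sum_mul_driftKernel, smul_eq_mul]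
  ring

theorem coef_zero (x : Cube N) (i : Fin (2 * N)) : coef 0 x i = 1 := by
  simp [coef]

theorem coef_of_weight_ne {x : Cube N} (h : weight x ≠ N) (δ : ℝ) (i : Fin (2 * N)) :
    coef δ x i = 1 := by
  simp [coef, h]

theorem abs_one_sub_two_mul_bit (x : Cube N) (i : Fin (2 * N)) : |1 - 2 * bit x i| = 1 := by
  rcases bit_eq_zero_or_one x i with h | h <;> norm_num [h]

theorem abs_coef_sub_one_le (δ : ℝ) (x : Cube N) (i : Fin (2 * N)) : |coef δ x i - 1| ≤ |δ| := by
  unfold coef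
  split_ifs
  · rw [add_sub_cancel_left, abs_mul, abs_one_sub_two_mul_bit, mul_one]
  · simp

theorem sum_one_sub_two_mul_bit (x : Cube N) :
    ∑ i, (1 - 2 * bit x i) = 2 * N - 2 * weight x := by
  rw [sum_sub_distrib, ← mul_sum, ← weight_eq_sum_bit]
  simp

/-- A middle vertex has as many zeros as ones, so the drift contributions cancel. -/
theorem sum_coef (δ : ℝ) (x : Cube N) : ∑ i, coef δ x i = 2 * N := by
  unfold coef
  split_ifs with h
  · rw [sum_add_distrib, ← mul_sum, sum_one_sub_two_mul_bit, h]
    simp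
  · simp

theorem coef_nonneg {δ : ℝ} (hδ : |δ| ≤ 1) (x : Cube N) (i : Fin (2 * N)) : 0 ≤ coef δ x i := by
  have := abs_le.1 (abs_coef_sub_one_le δ x i)
  linarith [this.1]

theorem bit_comp (σ : Perm (Fin (2 * N))) (x : Cube N) (i : Fin (2 * N)) :
    bit (x ∘ σ) i = bit x (σ i) := rfl

theorem weight_comp (σ : Perm (Fin (2 * N))) (x : Cube N) : weight (x ∘ σ) = weight x :=
  Equiv.sum_comp σ fun i => (x i : ℕ)

theorem flipAt_comp (σ : Perm (Fin (2 * N))) (x : Cube N) (i : Fin (2 * N)) :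
    flipAt i (x ∘ σ) = flipAt (σ i) x ∘ σ := by
  ext j : 1
  by_cases h : j = i
  · subst h
    simp [flipAt]
  · have : σ j ≠ σ i := σ.injective.ne h
    simp [flipAt, h]

theorem coef_comp (δ : ℝ) (σ : Perm (Fin (2 * N))) (x : Cube N) (i : Fin (2 * N)) :
    coef δ (x ∘ σ) i = coef δ x (σ i) := by
  simp [coef, weight_comp, bit_comp]

/-- The weights depend only on the level and on the flipped bit, so the kernel commutes with
permutations of the coordinates. This makes antisymmetry persist under all the kernels. -/
theorem lazyDriftKernel_mulVec_comp (δ : ℝ) (σ : Perm (Fin (2 * N))) (f : Cube N → ℝ)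
    (x : Cube N) :
    (lazyDriftKernel N δ *ᵥ f) (x ∘ σ) = (lazyDriftKernel N δ *ᵥ fun y => f (y ∘ σ)) x := by
  simp only [lazyDriftKernel_mulVec, flipAt_comp, coef_comp]
  rw [Equiv.sum_comp σ fun i => coef δ x i * f (flipAt i x ∘ σ)]

/-! ### Decay of functions antisymmetric in pairs of coordinates -/

/-- `g` changes sign when the coordinates `i` and `τ i` are exchanged, for each `i` moved by `τ`. -/
def IsAntisymm (τ : Perm (Fin (2 * N))) (g : Cube N → ℝ) : Prop :=
  ∀ i, τ i ≠ i → ∀ x, g (x ∘ swap i (τ i)) = -g x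

theorem IsAntisymm.eq_zero {τ : Perm (Fin (2 * N))} {g : Cube N → ℝ} (hg : IsAntisymm τ g)
    {i : Fin (2 * N)} (hi : τ i ≠ i) {x : Cube N} (hx : x i = x (τ i)) : g x = 0 := by
  have h := hg i hi x
  have : x ∘ swap i (τ i) = x := by
    ext j : 1
    simp only [Function.comp]
    by_cases h1 : j = i
    · rw [h1, swap_apply_left, hx]
    · by_cases h2 : j = τ i
      · rw [h2, swap_apply_right, hx]
      · rw [swap_apply_of_ne_of_ne h1 h2]
  rw [this] at h
  linarith

theorem IsAntisymm.mulVec {τ : Perm (Fin (2 * N))} {g : Cube N → ℝ} (hg : IsAntisymm τ g)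
    (δ : ℝ) : IsAntisymm τ (lazyDriftKernel N δ *ᵥ g) := by
  intro i hi x
  rw [lazyDriftKernel_mulVec_comp]
  have : (fun y => g (y ∘ swap i (τ i))) = -g := funext (hg i hi)
  rw [this, mulVec_neg, Pi.neg_apply]

theorem bit_add_bit_of_ne {x : Cube N} {i j : Fin (2 * N)} (h : x i ≠ x j) :
    bit x i + bit x j = 1 := by
  unfold bit
  revert h
  generalize x i = a
  generalize x j = b
  intro h
  fin_cases a <;> fin_cases b <;> simp_all

theorem sum_support_of_pair_sum {τ : Perm (Fin (2 * N))} (hτ : ∀ i, τ (τ i) = i)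
    {f : Fin (2 * N) → ℝ} {c : ℝ} (hf : ∀ i, τ i ≠ i → f i + f (τ i) = c) :
    ∑ i ∈ τ.support, f i = #τ.support * c / 2 := by
  have h1 : ∑ i ∈ τ.support, f (τ i) = ∑ i ∈ τ.support, f i :=
    sum_bij (fun i _ => τ i) (fun i hi => by simpa using hi)
      (fun i _ j _ h => τ.injective h)
      (fun i hi => ⟨τ i, by simpa using hi, hτ i⟩) (fun i _ => rfl)
  have h2 : ∑ i ∈ τ.support, (f i + f (τ i)) = #τ.support * c := by
    rw [sum_congr rfl fun i hi => hf i (Perm.mem_support.1 hi), sum_const, nsmul_eq_mul]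
  rw [sum_add_distrib, h1] at h2
  linarith

/-- An antisymmetric function vanishes as soon as the two bits of some pair agree. Where all pairs
disagree, flipping any coordinate of `τ.support` lands on a zero. The drift cancels within each
pair, so these lost flips have total weight exactly `#τ.support`, whatever `δ` is. -/
theorem IsAntisymm.abs_mulVec_le {τ : Perm (Fin (2 * N))} {g : Cube N → ℝ}
    (hg : IsAntisymm τ g) (hτ : ∀ i, τ (τ i) = i) (hN : 0 < N) {δ : ℝ} (hδ : |δ| ≤ 1) {B : ℝ}
    (hB : ∀ x, |g x| ≤ B) (x : Cube N) :
    |(lazyDriftKernel N δ *ᵥ g) x| ≤ B * (1 - #τ.support / (4 * N)) := by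
  have hB0 : 0 ≤ B := (abs_nonneg _).trans (hB x)
  have hN' : (0 : ℝ) < N := by exact_mod_cast hN
  have hcard : (#τ.support : ℝ) ≤ 2 * N := by
    have := card_le_univ τ.support
    rw [Fintype.card_fin] at this
    exact_mod_cast this
  by_cases hx : ∃ i, τ i ≠ i ∧ x i = x (τ i)
  · obtain ⟨i, hi, hxi⟩ := hx
    rw [(hg.mulVec δ).eq_zero hi hxi, abs_zero]
    refine mul_nonneg hB0 (sub_nonneg.2 ((div_le_one (by positivity)).2 (by linarith)))
  push Not at hx
  have hsupp : ∑ i ∈ τ.support, coef δ x i = #τ.support := by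
    rw [sum_support_of_pair_sum hτ (c := 2)]
    · ring
    · intro i hi
      have := bit_add_bit_of_ne (hx i hi)
      unfold coef
      split_ifs
      · linear_combination (-2 * δ) * this
      · norm_num
  have hterm : ∀ i ∈ τ.support, coef δ x i * g (flipAt i x) = 0 := by
    intro i hi
    have hi' := Perm.mem_support.1 hi
    have : flipAt i x i = flipAt i x (τ i) := by
      rw [flipAt_apply_self, flipAt_apply_of_ne hi']
      have := hx i hi'
      revert this
      generalize x i = a
      generalize x (τ i) = b
      revert a b
      decide
    rw [hg.eq_zero hi' this, mul_zero]
  rw [lazyDriftKernel_mulVec, ← sum_add_sum_compl τ.support, sum_eq_zero hterm, zero_add]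
  have h1 : |∑ i ∈ τ.supportᶜ, coef δ x i * g (flipAt i x)| ≤ (2 * N - #τ.support) * B := by
    refine (abs_sum_le_sum_abs _ _).trans ?_
    have h2 : ∑ i ∈ τ.supportᶜ, coef δ x i = 2 * N - #τ.support := by
      rw [← hsupp, ← sum_coef δ x, ← sum_add_sum_compl τ.support]
      ring
    rw [← h2, sum_mul]
    refine sum_le_sum fun i _ => ?_
    rw [abs_mul, abs_of_nonneg (coef_nonneg hδ x i)]
    exact mul_le_mul_of_nonneg_left (hB _) (coef_nonneg hδ x i)
  refine (abs_add_le _ _).trans ?_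
  rw [abs_mul, abs_mul, abs_of_pos (by norm_num : (0 : ℝ) < 1 / 2),
    abs_of_pos (by positivity : (0 : ℝ) < 1 / (4 * N))]
  calc 1 / 2 * |g x| + 1 / (4 * N) * |∑ i ∈ τ.supportᶜ, coef δ x i * g (flipAt i x)|
      ≤ 1 / 2 * B + 1 / (4 * N) * ((2 * N - #τ.support) * B) := by
        gcongr
        exact hB x
    _ = B * (1 - #τ.support / (4 * N)) := by
        field_simp
        ring

/-- The product `Q_{δ 1} ⋯ Q_{δ n}` of lazy kernels. -/
noncomputable abbrev driftProd (N : ℕ) (δ : ℕ → ℝ) (n : ℕ) : Matrix (Cube N) (Cube N) ℝ :=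
  compKernel (fun i => lazyDriftKernel N (δ i)) n

theorem driftProd_succ_mulVec (δ : ℕ → ℝ) (n : ℕ) (g : Cube N → ℝ) :
    driftProd N δ (n + 1) *ᵥ g = driftProd N δ n *ᵥ (lazyDriftKernel N (δ (n + 1)) *ᵥ g) := by
  rw [mulVec_mulVec]; rfl

/-- The factor by which `n` steps damp a function that depends on one coordinate. -/
noncomputable def damping (N n : ℕ) : ℝ := Real.exp (-n / (2 * N))

theorem damping_pos (N n : ℕ) : 0 < damping N n := Real.exp_pos _

theorem pow_le_damping_pow {j : ℕ} (hj : j ≤ 2 * N) (n : ℕ) :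
    (1 - (j : ℝ) / (2 * N)) ^ n ≤ damping N n ^ j := by
  have h0 : (0 : ℝ) ≤ 1 - (j : ℝ) / (2 * N) := by
    have : (j : ℝ) / (2 * N) ≤ 1 := div_le_one_of_le₀ (by exact_mod_cast hj) (by positivity)
    linarith
  calc (1 - (j : ℝ) / (2 * N)) ^ n ≤ Real.exp (-((j : ℝ) / (2 * N))) ^ n :=
        pow_le_pow_left₀ h0 (Real.one_sub_le_exp_neg _) n
    _ = damping N n ^ j := by
        rw [damping, ← Real.exp_nat_mul, ← Real.exp_nat_mul]
        congr 1
        ring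

theorem IsAntisymm.abs_driftProd_mulVec_le {τ : Perm (Fin (2 * N))} {g : Cube N → ℝ}
    (hg : IsAntisymm τ g) (hτ : ∀ i, τ (τ i) = i) (hN : 0 < N) {j : ℕ} (hj : #τ.support = 2 * j)
    {δ : ℕ → ℝ} (hδ : ∀ i, |δ i| ≤ 1) (hB : ∀ x, |g x| ≤ 1) (n : ℕ) (x : Cube N) :
    |(driftProd N δ n *ᵥ g) x| ≤ damping N n ^ j := by
  -- The last kernel acts on `g` first, so the induction must allow `g` and its bound to vary.
  have key : ∀ (n : ℕ) (g : Cube N → ℝ) (B : ℝ), IsAntisymm τ g → (∀ x, |g x| ≤ B) →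
      |(driftProd N δ n *ᵥ g) x| ≤ B * (1 - (j : ℝ) / (2 * N)) ^ n := by
    intro n
    induction n with
    | zero =>
      intro g B _ hB
      simpa [driftProd, compKernel] using hB x
    | succ n ih =>
      intro g B hg hB
      rw [driftProd_succ_mulVec, pow_succ']
      refine (ih _ _ (hg.mulVec _) (hg.abs_mulVec_le hτ hN (hδ (n + 1)) hB)).trans_eq ?_
      have : (#τ.support : ℝ) / (4 * N) = (j : ℝ) / (2 * N) := by
        rw [hj]; push_cast
        rw [show (4 : ℝ) * N = 2 * (2 * N) by ring]
        exact mul_div_mul_left _ _ two_ne_zero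
      rw [this]
      ring
  have hjN : j ≤ 2 * N := by
    have := card_le_univ τ.support
    rw [Fintype.card_fin] at this
    omega
  simpa using (key n g 1 hg hB).trans
    (mul_le_mul_of_nonneg_left (pow_le_damping_pow hjN n) zero_le_one)

/-! ### Near exchangeability of coordinates on the middle level -/

/-- A function supported on the middle level which is antisymmetric in the pairs `{i, τ i}` and
symmetric in the coordinates fixed by `τ`. -/
structure IsPairFunction (τ : Perm (Fin (2 * N))) (g : Cube N → ℝ) : Prop where
  invol : ∀ i, τ (τ i) = i
  antisymm : IsAntisymm τ g
  symm : ∀ i k, τ i = i → τ k = k → ∀ x, g (x ∘ swap i k) = g x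
  mid : ∀ x, weight x ≠ N → g x = 0
  abs_le_one : ∀ x, |g x| ≤ 1

/-- The indicator function of the middle level. -/
def midIndicator (N : ℕ) (x : Cube N) : ℝ := if weight x = N then 1 else 0

theorem isPairFunction_midIndicator : IsPairFunction 1 (midIndicator N) where
  invol _ := rfl
  antisymm i hi := absurd rfl hi
  symm i k _ _ x := by simp [midIndicator, weight_comp]
  mid x hx := by simp [midIndicator, hx]
  abs_le_one x := by unfold midIndicator; split_ifs <;> simp

theorem abs_bit_sub_bit_le (x : Cube N) (i k : Fin (2 * N)) : |bit x i - bit x k| ≤ 1 := by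
  rcases bit_eq_zero_or_one x i with h | h <;> rcases bit_eq_zero_or_one x k with h' | h' <;>
    simp [h, h']

theorem disjoint_swap_of_fixed {τ : Perm (Fin (2 * N))} {i k : Fin (2 * N)}
    (hi : τ i = i) (hk : τ k = k) : Perm.Disjoint (swap i k) τ := by
  intro l
  by_cases h1 : l = i
  · right; rw [h1, hi]
  · by_cases h2 : l = k
    · right; rw [h2, hk]
    · left; exact swap_apply_of_ne_of_ne h1 h2

/-- Each difference of two still symmetric bits creates one new antisymmetric pair, hence one more
factor of decay. -/
theorem IsPairFunction.extend {τ : Perm (Fin (2 * N))} {g : Cube N → ℝ}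
    (hg : IsPairFunction τ g) {i k : Fin (2 * N)} (hik : i ≠ k) (hi : τ i = i) (hk : τ k = k) :
    IsPairFunction (swap i k * τ) fun x => g x * (bit x i - bit x k) := by
  have hτi : (swap i k * τ) i = k := by simp [hi]
  have hτk : (swap i k * τ) k = i := by simp [hk]
  have hτl : ∀ l, l ≠ i → l ≠ k → (swap i k * τ) l = τ l ∧ τ l ≠ i ∧ τ l ≠ k := by
    intro l h1 h2
    have h3 : τ l ≠ i := fun h => h1 (τ.injective (h.trans hi.symm))
    have h4 : τ l ≠ k := fun h => h2 (τ.injective (h.trans hk.symm))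
    exact ⟨by simp [swap_apply_of_ne_of_ne h3 h4], h3, h4⟩
  have hfix : ∀ l, (swap i k * τ) l = l → τ l = l ∧ l ≠ i ∧ l ≠ k := by
    intro l hl
    have h1 : l ≠ i := by rintro rfl; exact hik (hl.symm.trans hτi)
    have h2 : l ≠ k := by rintro rfl; exact hik (hτk.symm.trans hl)
    exact ⟨(hτl l h1 h2).1 ▸ hl, h1, h2⟩
  refine ⟨fun l => ?_, fun l hl x => ?_, fun l m hl hm x => ?_, fun x hx => ?_, fun x => ?_⟩
  · by_cases h1 : l = i
    · rw [h1, hτi, hτk]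
    · by_cases h2 : l = k
      · rw [h2, hτk, hτi]
      · obtain ⟨h3, h4, h5⟩ := hτl l h1 h2
        rw [h3, (hτl _ h4 h5).1, hg.invol]
  · by_cases h1 : l = i
    · rw [h1, hτi, hg.symm i k hi hk, bit_comp, bit_comp, swap_apply_left, swap_apply_right]
      ring
    · by_cases h2 : l = k
      · rw [h2, hτk, hg.symm k i hk hi, bit_comp, bit_comp, swap_apply_left, swap_apply_right]
        ring
      · obtain ⟨h3, h4, h5⟩ := hτl l h1 h2
        rw [h3] at hl ⊢
        rw [hg.antisymm l hl, bit_comp, bit_comp, swap_apply_of_ne_of_ne (Ne.symm h1) h4.symm,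
          swap_apply_of_ne_of_ne (Ne.symm h2) h5.symm]
        ring
  · obtain ⟨hl, hli, hlk⟩ := hfix l hl
    obtain ⟨hm, hmi, hmk⟩ := hfix m hm
    rw [hg.symm l m hl hm, bit_comp, bit_comp, swap_apply_of_ne_of_ne hli.symm hmi.symm,
      swap_apply_of_ne_of_ne hlk.symm hmk.symm]
  · rw [hg.mid x hx, zero_mul]
  · rw [abs_mul]
    exact mul_le_one₀ (hg.abs_le_one x) (abs_nonneg _) (abs_bit_sub_bit_le x i k)

theorem prod_bit_mul_bit (x : Cube N) {T : Finset (Fin (2 * N))} {i : Fin (2 * N)} (hi : i ∈ T) :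
    (∏ l ∈ T, bit x l) * bit x i = ∏ l ∈ T, bit x l := by
  rcases bit_eq_zero_or_one x i with h | h
  · rw [prod_eq_zero hi h, zero_mul]
  · rw [h, mul_one]

/-- Where `g` is nonzero, the level is `N` and each pair contains exactly one 1, so the coordinates
outside `τ.support` have sum `N - j`. Comparing bit `i` with every other free coordinate `k` thus
replaces it by its conditional mean given that the bits in `T` are 1, up to the differences `bit x i
- bit x k`. -/
theorem IsPairFunction.mul_prod_insert {τ : Perm (Fin (2 * N))} {g : Cube N → ℝ}
    (hg : IsPairFunction τ g) {j : ℕ} (hj : #τ.support = 2 * j) {T : Finset (Fin (2 * N))}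
    {i : Fin (2 * N)} (hiT : i ∉ T) (hT : Disjoint (insert i T) τ.support) (x : Cube N) :
    (2 * ((N : ℝ) - j) - #T) * (g x * ∏ l ∈ insert i T, bit x l) =
      ((N : ℝ) - j - #T) * (g x * ∏ l ∈ T, bit x l) +
        ∑ k ∈ (insert i T ∪ τ.support)ᶜ,
          (g x * (bit x i - bit x k)) * ∏ l ∈ T, bit x l := by
  by_cases h0 : g x = 0
  · simp [h0]
  have hw : weight x = N := by
    by_contra h
    exact h0 (hg.mid x h)
  have hpair : ∑ l ∈ τ.support, bit x l = j := by
    rw [sum_support_of_pair_sum hg.invol (c := 1), hj]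
    · push_cast; ring
    · exact fun l hl => bit_add_bit_of_ne fun h => h0 (hg.antisymm.eq_zero hl h)
  have htot : ∑ l, bit x l = N := by rw [← weight_eq_sum_bit, hw]
  rw [← sum_add_sum_compl (insert i T ∪ τ.support), sum_union hT, sum_insert hiT, hpair] at htot
  have hcard : (#(insert i T ∪ τ.support)ᶜ : ℝ) = 2 * N - (#T + 1 + 2 * j) := by
    have h1 := card_add_card_compl (insert i T ∪ τ.support)
    rw [card_union_of_disjoint hT, card_insert_of_notMem hiT, hj, Fintype.card_fin] at h1
    have h2 : ((#T + 1 + 2 * j + #(insert i T ∪ τ.support)ᶜ : ℕ) : ℝ) = (2 * N : ℕ) := by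
      rw [h1]
    push_cast at h2
    linarith
  have hprod : (∏ l ∈ T, bit x l) * ∑ l ∈ T, bit x l = #T * ∏ l ∈ T, bit x l := by
    rw [mul_sum, sum_congr rfl fun l hl => prod_bit_mul_bit x hl, sum_const, nsmul_eq_mul]
  have hsum : ∑ k ∈ (insert i T ∪ τ.support)ᶜ, (g x * (bit x i - bit x k)) * ∏ l ∈ T, bit x l
      = g x * (#(insert i T ∪ τ.support)ᶜ * bit x i - ∑ k ∈ (insert i T ∪ τ.support)ᶜ, bit x k)
        * ∏ l ∈ T, bit x l := by
    rw [← sum_mul, ← mul_sum, sum_sub_distrib, sum_const, nsmul_eq_mul]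
  rw [hsum, hcard, prod_insert hiT]
  linear_combination (-g x) * hprod + (g x * ∏ l ∈ T, bit x l) * htot

/-- The probability that `r` given coordinates of a uniform vertex of the middle level of the
`2m`-dimensional cube are equal to `1`. -/
noncomputable def midProb (m : ℝ) : ℕ → ℝ
  | 0 => 1
  | r + 1 => midProb m r * ((m - r) / (2 * m - r))

theorem midProb_nonneg {m : ℝ} {r : ℕ} (h : (r : ℝ) ≤ m) : 0 ≤ midProb m r := by
  induction r with
  | zero => exact zero_le_one
  | succ r ih =>
    push_cast at h
    have hr : (0 : ℝ) ≤ r := r.cast_nonneg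
    exact mul_nonneg (ih (by linarith)) (div_nonneg (by linarith) (by linarith))

/-- Turning a comparison into a new pair lowers `m` by one. This identity converts the constants for
`m - 1` back to those for `m` in the induction over `T`. -/
theorem midProb_sub_one {m : ℝ} {r : ℕ} (h : (r : ℝ) + 1 ≤ m) :
    (2 * m - r - 1) * midProb (m - 1) r = 2 * (2 * m - 1) * midProb m (r + 1) := by
  induction r with
  | zero =>
    have : m ≠ 0 := by norm_num at h; linarith
    simp only [midProb, Nat.cast_zero]
    field_simp
    ring
  | succ r ih =>
    push_cast at h
    have ih := ih (by linarith)
    have hr : (0 : ℝ) ≤ r := r.cast_nonneg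
    have h1 : 2 * m - r - 1 ≠ 0 := by linarith
    have h2 : 2 * (m - 1) - r ≠ 0 := by linarith
    have h3 : 2 * m - (r + 1) ≠ 0 := by linarith
    rw [midProb, midProb]
    push_cast
    have e : midProb m (r + 1) = (2 * m - r - 1) * midProb (m - 1) r / (2 * (2 * m - 1)) := by
      rw [ih]
      have : 2 * m - 1 ≠ 0 := by linarith
      field_simp
    rw [e]
    have : 2 * m - 1 ≠ 0 := by linarith
    field_simp
    ring

/-- At `r = N` this identifies the constant as the uniform mass of one middle vertex. -/
theorem midProb_mul_choose (N r : ℕ) (h : r ≤ N) :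
    midProb N r * (2 * N).choose N = (2 * N - r).choose N := by
  induction r with
  | zero => simp [midProb]
  | succ r ih =>
    have ih := ih (by omega)
    have h1 := Nat.choose_mul_succ_eq (2 * N - (r + 1)) N
    rw [show 2 * N - (r + 1) + 1 = 2 * N - r by omega, show 2 * N - r - N = N - r by omega] at h1
    have h2 : ((2 * N - (r + 1)).choose N : ℝ) * (2 * N - r) = (2 * N - r).choose N * (N - r) := by
      have := congrArg (Nat.cast : ℕ → ℝ) h1
      push_cast [Nat.cast_sub (show r ≤ 2 * N by omega), Nat.cast_sub (show r ≤ N by omega)] at this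
      exact this
    have h3 : (2 * N - r : ℝ) ≠ 0 := by
      have : ((r : ℝ) + 1) ≤ N := by exact_mod_cast h
      have : (0 : ℝ) ≤ r := r.cast_nonneg
      linarith
    rw [midProb, eq_comm, ← mul_right_inj' h3, mul_comm, h2, ← ih]
    generalize (2 * N - r : ℝ) = d at h3 ⊢
    field_simp

/-- Induction on `T`, over all pair functions at once: removing a coordinate gives a main term with
the same `g` and correction terms whose pair function has one more pair. Those gain a factor `θ`,
and the corrections sum up to a power of `1 + 4θ`. -/
theorem IsPairFunction.abs_driftProd_mulVec_sub_le {δ : ℕ → ℝ} (hδ : ∀ i, |δ i| ≤ 1)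
    (hN : 0 < N) (n : ℕ) (x : Cube N) (T : Finset (Fin (2 * N))) :
    ∀ (τ : Perm (Fin (2 * N))) (g : Cube N → ℝ) (j : ℕ), IsPairFunction τ g →
      #τ.support = 2 * j → Disjoint T τ.support → j + #T ≤ N →
      |(driftProd N δ n *ᵥ fun y => g y * ∏ l ∈ T, bit y l) x -
          midProb ((N : ℝ) - j) #T * (driftProd N δ n *ᵥ g) x| ≤
        midProb ((N : ℝ) - j) #T * damping N n ^ j * ((1 + 4 * damping N n) ^ #T - 1) := by
  have hθ := (damping_pos N n).le
  induction T using Finset.induction_on with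
  | empty =>
    intro τ g j _ _ _ _
    simp [midProb]
  | insert i T hiT ih =>
    intro τ g j hg hj hT hle
    rw [card_insert_of_notMem hiT] at hle ⊢
    set A := driftProd N δ n
    set θ := damping N n
    set m : ℝ := (N : ℝ) - j with hm
    set r := #T
    set R := (insert i T ∪ τ.support)ᶜ
    have hrm : (r : ℝ) + 1 ≤ m := by
      have : ((j + (r + 1) : ℕ) : ℝ) ≤ N := by exact_mod_cast hle
      push_cast at this
      linarith
    have hr0 : (0 : ℝ) ≤ r := r.cast_nonneg
    have hTdisj : Disjoint T τ.support := hT.mono_left (subset_insert i T)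
    have hcardR : (#R : ℝ) = 2 * m - r - 1 := by
      have h1 := card_add_card_compl (insert i T ∪ τ.support)
      rw [card_union_of_disjoint hT, card_insert_of_notMem hiT, hj, Fintype.card_fin] at h1
      have h2 : ((r + 1 + 2 * j + #R : ℕ) : ℝ) = (2 * N : ℕ) := by
        rw [h1]
      push_cast at h2
      linarith
    have hi : τ i = i := by
      have := disjoint_left.1 hT (mem_insert_self i T)
      simpa using this
    have hR : ∀ k ∈ R, |(A *ᵥ fun y => (g y * (bit y i - bit y k)) * ∏ l ∈ T, bit y l) x| ≤
        midProb (m - 1) r * θ ^ (j + 1) * (1 + 4 * θ) ^ r := by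
      intro k hk
      simp only [R, mem_compl, mem_union, mem_insert, not_or, Perm.mem_support, not_not] at hk
      obtain ⟨⟨hki, hkT⟩, hkτ⟩ := hk
      have hext := hg.extend (Ne.symm hki) hi hkτ
      have hdisj := disjoint_swap_of_fixed hi hkτ
      have hcard : #(swap i k * τ).support = 2 * (j + 1) := by
        rw [hdisj.card_support_mul, Perm.card_support_swap (Ne.symm hki), hj]
        ring
      have hTd : Disjoint T (swap i k * τ).support := by
        rw [hdisj.support_mul, disjoint_union_right]
        refine ⟨?_, hTdisj⟩
        rw [Perm.support_swap (Ne.symm hki)]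
        simp [hiT, hkT]
      have h1 := ih _ _ (j + 1) hext hcard hTd (by omega)
      have h2 := hext.antisymm.abs_driftProd_mulVec_le hext.invol hN hcard hδ hext.abs_le_one n x
      have hm1 : (N : ℝ) - (j + 1 : ℕ) = m - 1 := by push_cast; ring
      rw [hm1] at h1
      have hmp : 0 ≤ midProb (m - 1) r := midProb_nonneg (by linarith)
      have h3 := abs_add_le ((A *ᵥ fun y => (g y * (bit y i - bit y k)) * ∏ l ∈ T, bit y l) x -
        midProb (m - 1) r * (A *ᵥ fun y => g y * (bit y i - bit y k)) x)
        (midProb (m - 1) r * (A *ᵥ fun y => g y * (bit y i - bit y k)) x)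
      rw [sub_add_cancel, abs_mul (midProb (m - 1) r), abs_of_nonneg hmp] at h3
      have h4 := mul_le_mul_of_nonneg_left h2 hmp
      refine h3.trans ((add_le_add h1 h4).trans_eq ?_)
      ring
    have hlin : (2 * m - r) * (A *ᵥ fun y => g y * ∏ l ∈ insert i T, bit y l) x =
        (m - r) * (A *ᵥ fun y => g y * ∏ l ∈ T, bit y l) x +
          ∑ k ∈ R, (A *ᵥ fun y => (g y * (bit y i - bit y k)) * ∏ l ∈ T, bit y l) x := by
      simp only [mulVec, dotProduct]
      rw [sum_comm, mul_sum, mul_sum, ← sum_add_distrib]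
      refine sum_congr rfl fun y _ => ?_
      rw [← mul_sum]
      linear_combination A x y * hg.mul_prod_insert hj hiT hT y
    have hsum := (abs_sum_le_sum_abs _ _).trans (sum_le_sum hR)
    rw [sum_const, nsmul_eq_mul, hcardR] at hsum
    have hmain := ih τ g j hg hj hTdisj (by omega)
    have hp : 0 < 2 * m - r := by linarith
    have hmp : 0 ≤ midProb m (r + 1) := midProb_nonneg (by push_cast; linarith)
    have hrec : (2 * m - r) * midProb m (r + 1) = (m - r) * midProb m r := by
      rw [midProb]
      field_simp
    have hdiff : (2 * m - r) * ((A *ᵥ fun y => g y * ∏ l ∈ insert i T, bit y l) x -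
          midProb m (r + 1) * (A *ᵥ g) x) =
        (m - r) * ((A *ᵥ fun y => g y * ∏ l ∈ T, bit y l) x - midProb m r * (A *ᵥ g) x) +
          ∑ k ∈ R, (A *ᵥ fun y => (g y * (bit y i - bit y k)) * ∏ l ∈ T, bit y l) x := by
      linear_combination hlin - (A *ᵥ g) x * hrec
    refine le_of_mul_le_mul_left ?_ hp
    rw [← abs_of_pos hp, ← abs_mul, hdiff, abs_of_pos hp]
    refine (abs_add_le _ _).trans ?_
    rw [abs_mul, abs_of_nonneg (by linarith : (0 : ℝ) ≤ m - r)]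
    have h5 := mul_le_mul_of_nonneg_left hmain (by linarith : (0 : ℝ) ≤ m - r)
    -- The 4 in `1 + 4θ` comes from here: by `midProb_sub_one` it suffices that `2(2m - 1) ≤ 4(2m -
    -- r)`, which follows from `r + 1 ≤ m`.
    have h6 : (2 * m - r - 1) * (midProb (m - 1) r * θ ^ (j + 1) * (1 + 4 * θ) ^ r) ≤
        4 * (2 * m - r) * midProb m (r + 1) * (θ ^ (j + 1) * (1 + 4 * θ) ^ r) := by
      have h7 : (2 * m - r - 1) * midProb (m - 1) r ≤ 4 * (2 * m - r) * midProb m (r + 1) := by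
        rw [midProb_sub_one hrm]
        exact mul_le_mul_of_nonneg_right (by linarith) hmp
      have h8 : 0 ≤ θ ^ (j + 1) * (1 + 4 * θ) ^ r := by positivity
      calc _ = (2 * m - r - 1) * midProb (m - 1) r * (θ ^ (j + 1) * (1 + 4 * θ) ^ r) := by ring
        _ ≤ _ := mul_le_mul_of_nonneg_right h7 h8
    refine (add_le_add h5 (hsum.trans h6)).trans_eq ?_
    rw [pow_succ (1 + 4 * θ) r, pow_succ θ j]
    linear_combination (-(θ ^ j * ((1 + 4 * θ) ^ r - 1))) * hrec

/-! ### Spectral analysis of the driftless walk -/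

/-- The product of the signs `(-1) ^ x i` over `i ∈ A`. -/
def walsh (A : Finset (Fin (2 * N))) (x : Cube N) : ℝ := ∏ i ∈ A, (1 - 2 * bit x i)

theorem abs_walsh (A : Finset (Fin (2 * N))) (x : Cube N) : |walsh A x| = 1 := by
  rw [walsh, abs_prod]
  exact prod_eq_one fun i _ => abs_one_sub_two_mul_bit x i

theorem walsh_flipAt (A : Finset (Fin (2 * N))) (i : Fin (2 * N)) (x : Cube N) :
    walsh A (flipAt i x) = if i ∈ A then -walsh A x else walsh A x := by
  unfold walsh
  split_ifs with h
  · rw [← mul_prod_erase A _ h, ← mul_prod_erase A (fun i => 1 - 2 * bit x i) h, bit_flipAt_self,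
      prod_congr rfl fun j hj => by rw [bit_flipAt_of_ne (ne_of_mem_erase hj)]]
    ring
  · refine prod_congr rfl fun j hj => ?_
    rw [bit_flipAt_of_ne]
    rintro rfl
    exact h hj

theorem lazyDriftKernel_zero_mulVec_walsh (hN : 0 < N) (A : Finset (Fin (2 * N))) :
    lazyDriftKernel N 0 *ᵥ walsh A = (1 - (#A : ℝ) / (2 * N)) • walsh A := by
  ext x
  have hN' : (N : ℝ) ≠ 0 := by exact_mod_cast hN.ne'
  have h : ∑ i, walsh A (flipAt i x) = (2 * N - 2 * #A) * walsh A x := by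
    have h1 : ∀ i, walsh A (flipAt i x) = walsh A x - if i ∈ A then 2 * walsh A x else 0 := by
      intro i
      rw [walsh_flipAt]
      split_ifs <;> ring
    rw [sum_congr rfl fun i _ => h1 i, sum_sub_distrib, sum_ite_mem, univ_inter, sum_const,
      sum_const, card_univ, Fintype.card_fin, nsmul_eq_mul, nsmul_eq_mul]
    push_cast
    ring
  rw [lazyDriftKernel_mulVec]
  simp only [coef_zero, one_mul, Pi.smul_apply, smul_eq_mul, h]
  field_simp
  ring

theorem pow_lazyDriftKernel_zero_mulVec_walsh (hN : 0 < N) (A : Finset (Fin (2 * N))) (n : ℕ) :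
    lazyDriftKernel N 0 ^ n *ᵥ walsh A = (1 - (#A : ℝ) / (2 * N)) ^ n • walsh A := by
  induction n with
  | zero => simp
  | succ n ih =>
    rw [pow_succ, ← mulVec_mulVec, lazyDriftKernel_zero_mulVec_walsh hN, mulVec_smul, ih,
      smul_smul, pow_succ']

theorem sum_walsh_mul_walsh (x z : Cube N) :
    ∑ A, walsh A z * walsh A x = if x = z then (4 : ℝ) ^ N else 0 := by
  have h1 : ∑ A, walsh A z * walsh A x =
      ∏ i, (1 + (1 - 2 * bit z i) * (1 - 2 * bit x i)) := by
    rw [prod_one_add, powerset_univ]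
    exact sum_congr rfl fun A _ => prod_mul_distrib.symm
  rw [h1]
  split_ifs with h
  · subst h
    have : ∀ i, 1 + (1 - 2 * bit x i) * (1 - 2 * bit x i) = (2 : ℝ) := by
      intro i
      rcases bit_eq_zero_or_one x i with h | h <;> norm_num [h]
    rw [prod_congr rfl fun i _ => this i, prod_const, card_univ, Fintype.card_fin, pow_mul]
    norm_num
  · obtain ⟨i, hi⟩ := Function.ne_iff.1 h
    refine prod_eq_zero (mem_univ i) ?_
    have : bit x i + bit z i = 1 := by
      unfold bit
      revert hi
      generalize x i = a
      generalize z i = b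
      intro hi
      fin_cases a <;> fin_cases b <;> simp_all
    rcases bit_eq_zero_or_one x i with h | h <;> rw [h] at this ⊢
    · linear_combination -2 * this
    · linear_combination 2 * this

theorem sum_pow_card_univ (t : ℝ) : ∑ A : Finset (Fin (2 * N)), t ^ #A = (1 + t) ^ (2 * N) := by
  have := prod_one_add (R := ℝ) (univ : Finset (Fin (2 * N))) (f := fun _ => t)
  simp only [prod_const, card_univ, Fintype.card_fin, powerset_univ] at this
  exact this.symm

/-- Relative uniform convergence of the simple random walk. -/
theorem abs_pow_lazyDriftKernel_zero_sub_le (hN : 0 < N) (n : ℕ) (x z : Cube N) :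
    |(4 : ℝ) ^ N * (lazyDriftKernel N 0 ^ n) x z - 1| ≤ (1 + damping N n) ^ (2 * N) - 1 := by
  have h1 : (4 : ℝ) ^ N * (lazyDriftKernel N 0 ^ n) x z =
      ∑ A, (1 - (#A : ℝ) / (2 * N)) ^ n * (walsh A z * walsh A x) := by
    have h2 : ∑ y, (lazyDriftKernel N 0 ^ n) x y * ∑ A, walsh A z * walsh A y =
        (lazyDriftKernel N 0 ^ n) x z * 4 ^ N := by
      simp [sum_walsh_mul_walsh]
    rw [mul_comm, ← h2]
    simp only [mul_sum]
    rw [sum_comm]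
    refine sum_congr rfl fun A _ => ?_
    have h3 := congrFun (pow_lazyDriftKernel_zero_mulVec_walsh hN A n) x
    simp only [mulVec, dotProduct, Pi.smul_apply, smul_eq_mul] at h3
    calc _ = walsh A z * ∑ y, (lazyDriftKernel N 0 ^ n) x y * walsh A y := by
          rw [mul_sum]
          exact sum_congr rfl fun y _ => by ring
      _ = _ := by rw [h3]; ring
  -- The empty set contributes the limit 1, and every other Walsh function is an error term.
  rw [h1, ← sum_pow_card_univ, ← add_sum_erase _ _ (mem_univ ∅),
    ← add_sum_erase univ (fun A : Finset (Fin (2 * N)) => damping N n ^ #A) (mem_univ ∅)]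
  simp only [card_empty, Nat.cast_zero, zero_div, sub_zero, one_pow, walsh, prod_empty, mul_one,
    pow_zero, add_sub_cancel_left]
  refine (abs_sum_le_sum_abs _ _).trans (sum_le_sum fun A _ => ?_)
  have hA : #A ≤ 2 * N := by
    simpa using card_le_univ A
  have h0 : (0 : ℝ) ≤ 1 - (#A : ℝ) / (2 * N) := by
    have : (#A : ℝ) / (2 * N) ≤ 1 := div_le_one_of_le₀ (by exact_mod_cast hA) (by positivity)
    linarith
  have h4 := abs_walsh A z
  have h5 := abs_walsh A x
  unfold walsh at h4 h5
  rw [abs_mul, abs_mul, h4, h5, mul_one, mul_one, abs_of_nonneg (pow_nonneg h0 n)]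
  exact pow_le_damping_pow hA n

/-! ### Functions that do not see the drift -/

/-- A function of the level which is invariant under the exchange of `0` and `1`. -/
def IsEvenLevel (h : Cube N → ℝ) : Prop :=
  ∃ c : ℝ → ℝ, (∀ t, c (-t) = c t) ∧ ∀ x, h x = c (weight x - N)

/-- The drift acts only at middle vertices. All neighbours of such a vertex carry the same value `c
1 = c (-1)`, so only the total weight matters. -/
theorem IsEvenLevel.mulVec {h : Cube N → ℝ} (hh : IsEvenLevel h) (δ : ℝ) :
    lazyDriftKernel N δ *ᵥ h = lazyDriftKernel N 0 *ᵥ h := by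
  obtain ⟨c, hc, hx⟩ := hh
  ext x
  rw [lazyDriftKernel_mulVec, lazyDriftKernel_mulVec]
  congr 2
  by_cases hw : weight x = N
  · have : ∀ i, h (flipAt i x) = c 1 := by
      intro i
      rw [hx, weight_flipAt, hw]
      rcases bit_eq_zero_or_one x i with hb | hb <;> rw [hb]
      · ring_nf
      · rw [← hc]; ring_nf
    simp only [this]
    rw [← sum_mul, ← sum_mul, sum_coef, sum_coef]
  · simp only [coef_of_weight_ne hw]

theorem IsEvenLevel.mulVec_zero {h : Cube N → ℝ} (hh : IsEvenLevel h) :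
    IsEvenLevel (lazyDriftKernel N 0 *ᵥ h) := by
  obtain ⟨c, hc, hx⟩ := hh
  refine ⟨fun t => 1 / 2 * c t + 1 / (4 * N) * ((N - t) * c (t + 1) + (N + t) * c (t - 1)),
    fun t => ?_, fun x => ?_⟩
  · simp only
    rw [hc t, ← hc (-t + 1), ← hc (-t - 1)]
    ring_nf
  · rw [lazyDriftKernel_mulVec, hx x]
    simp only [coef_zero, one_mul]
    congr 2
    set t : ℝ := weight x - N with ht
    have h1 : ∀ i, h (flipAt i x) = c (t + 1) + bit x i * (c (t - 1) - c (t + 1)) := by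
      intro i
      rw [hx, weight_flipAt]
      rcases bit_eq_zero_or_one x i with hb | hb <;> rw [hb, ht] <;> ring_nf
    rw [sum_congr rfl fun i _ => h1 i, sum_add_distrib, ← sum_mul, ← weight_eq_sum_bit]
    simp only [sum_const, card_univ, Fintype.card_fin, nsmul_eq_mul]
    push_cast
    rw [show (weight x : ℝ) = t + N by rw [ht]; ring]
    ring

theorem IsEvenLevel.driftProd_mulVec {h : Cube N → ℝ} (hh : IsEvenLevel h) (δ : ℕ → ℝ) (n : ℕ) :
    driftProd N δ n *ᵥ h = lazyDriftKernel N 0 ^ n *ᵥ h := by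
  induction n generalizing h with
  | zero => simp [driftProd, compKernel]
  | succ n ih =>
    rw [driftProd_succ_mulVec, hh.mulVec, ih hh.mulVec_zero, mulVec_mulVec, pow_succ]

theorem isEvenLevel_midIndicator : IsEvenLevel (midIndicator N) := by
  refine ⟨fun t => if t = 0 then 1 else 0, fun t => by simp, fun x => ?_⟩
  simp [midIndicator, sub_eq_zero]

theorem weight_eq_card (x : Cube N) : weight x = #{i | x i = 1} := by
  rw [weight, card_filter]
  refine sum_congr rfl fun i _ => ?_
  generalize x i = a
  fin_cases a <;> simp

theorem card_middle : #{x : Cube N | weight x = N} = (2 * N).choose N := by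
  have h : #(powersetCard N (univ : Finset (Fin (2 * N)))) = (2 * N).choose N := by
    rw [card_powersetCard, card_univ, Fintype.card_fin]
  rw [← h]
  refine card_nbij' (fun x => ({i | x i = 1} : Finset _)) (fun T i => if i ∈ T then 1 else 0)
    ?_ ?_ ?_ ?_
  · intro x hx
    simpa [mem_powersetCard, weight_eq_card] using hx
  · intro T hT
    simp only [mem_coe, mem_powersetCard, subset_univ, true_and] at hT
    simp [weight_eq_card, hT]
  · intro x _
    ext i : 1
    simp only [mem_filter, mem_univ, true_and]
    generalize x i = a
    fin_cases a <;> simp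
  · intro T _
    ext i
    simp

theorem sum_midIndicator : ∑ x, midIndicator N x = (2 * N).choose N := by
  simp only [midIndicator]
  rw [sum_boole, card_middle]

theorem abs_driftProd_mulVec_midIndicator_sub_le (hN : 0 < N) (δ : ℕ → ℝ) (n : ℕ) (x : Cube N) :
    |(4 : ℝ) ^ N * (driftProd N δ n *ᵥ midIndicator N) x - (2 * N).choose N| ≤
      (2 * N).choose N * ((1 + damping N n) ^ (2 * N) - 1) := by
  rw [isEvenLevel_midIndicator.driftProd_mulVec, ← sum_midIndicator, mulVec, dotProduct, mul_sum,
    ← sum_sub_distrib, sum_mul]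
  refine (abs_sum_le_sum_abs _ _).trans (sum_le_sum fun z _ => ?_)
  have h0 : 0 ≤ midIndicator N z := by unfold midIndicator; split_ifs <;> simp
  rw [show (4 : ℝ) ^ N * ((lazyDriftKernel N 0 ^ n) x z * midIndicator N z) - midIndicator N z =
    midIndicator N z * (4 ^ N * (lazyDriftKernel N 0 ^ n) x z - 1) by ring, abs_mul,
    abs_of_nonneg h0]
  exact mul_le_mul_of_nonneg_left (abs_pow_lazyDriftKernel_zero_sub_le hN n x z) h0

/-! ### Pointwise convergence on the middle level -/

theorem midIndicator_mul_prod {z : Cube N} (hz : weight z = N) (y : Cube N) :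
    midIndicator N y * ∏ l with z l = 1, bit y l = if y = z then 1 else 0 := by
  split_ifs with h
  · subst h
    rw [midIndicator, if_pos hz, one_mul]
    refine prod_eq_one fun l hl => ?_
    simp [bit, (mem_filter.1 hl).2]
  · unfold midIndicator
    split_ifs with hy
    · rw [one_mul]
      by_contra hne
      have h1 : ({l | z l = 1} : Finset (Fin (2 * N))) ⊆
          ({l | y l = 1} : Finset (Fin (2 * N))) := by
        intro l hl
        have := prod_ne_zero_iff.1 hne l hl
        simp only [mem_filter, mem_univ, true_and]
        revert this
        unfold bit
        generalize y l = a
        fin_cases a <;> simp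
      have h2 := eq_of_subset_of_card_le h1
        (by rw [← weight_eq_card, ← weight_eq_card, hy, hz])
      refine h (funext fun l => ?_)
      have h3 : z l = 1 ↔ y l = 1 := by
        simpa using congrArg (l ∈ ·) h2
      revert h3
      generalize z l = a
      generalize y l = b
      revert a b
      decide
    · rw [zero_mul]

/-- Uniform convergence on the middle level, from all starting points. -/
theorem abs_driftProd_mid_sub_one_le (hN : 0 < N) {δ : ℕ → ℝ} (hδ : ∀ i, |δ i| ≤ 1) (n : ℕ)
    (x : Cube N) {z : Cube N} (hz : weight z = N) :
    |(4 : ℝ) ^ N * driftProd N δ n x z - 1| ≤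
      2 * N * ((1 + 4 * damping N n) ^ N - 1) + ((1 + damping N n) ^ (2 * N) - 1) := by
  have h1 := IsPairFunction.abs_driftProd_mulVec_sub_le hδ hN n x
    ({l | z l = 1} : Finset _) 1 (midIndicator N) 0
    isPairFunction_midIndicator (by simp) (by simp) (by rw [← weight_eq_card, hz]; omega)
  have h2 : (driftProd N δ n *ᵥ fun y => midIndicator N y * ∏ l with z l = 1, bit y l) x =
      driftProd N δ n x z := by
    simp [mulVec, dotProduct, midIndicator_mul_prod hz]
  have h3 := midProb_mul_choose N N le_rfl
  rw [show 2 * N - N = N by omega, Nat.choose_self, Nat.cast_one] at h3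
  rw [h2, ← weight_eq_card, hz, Nat.cast_zero, sub_zero, pow_zero, mul_one] at h1
  have h4 := abs_driftProd_mulVec_midIndicator_sub_le hN δ n x
  have h5 : (4 : ℝ) ^ N ≤ 2 * N * (2 * N).choose N := by
    have := Nat.four_pow_le_two_mul_self_mul_centralBinom N hN
    rw [Nat.centralBinom_eq_two_mul_choose] at this
    exact_mod_cast this
  have hC : (0 : ℝ) < (2 * N).choose N := by
    exact_mod_cast Nat.choose_pos (by omega)
  set C : ℝ := ((2 * N).choose N : ℝ)
  set p := midProb (N : ℝ) N
  have hp : 0 < p := pos_of_mul_pos_left (h3 ▸ one_pos) hC.le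
  set M := (driftProd N δ n *ᵥ midIndicator N) x
  -- The first term measures unevenness within the level, the second the error in the total mass of
  -- the level. Here `p * C = 1`.
  have e : (4 : ℝ) ^ N * driftProd N δ n x z - 1 =
      4 ^ N * (driftProd N δ n x z - p * M) + p * (4 ^ N * M - C) := by
    linear_combination h3
  have hE : 0 ≤ (1 + 4 * damping N n) ^ N - 1 :=
    sub_nonneg.2 (one_le_pow₀ (by linarith [damping_pos N n]))
  rw [e]
  refine (abs_add_le _ _).trans (add_le_add ?_ ?_)
  · rw [abs_mul, abs_of_pos (by positivity)]
    calc _ ≤ 4 ^ N * (p * ((1 + 4 * damping N n) ^ N - 1)) := by gcongr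
      _ ≤ 2 * N * C * (p * ((1 + 4 * damping N n) ^ N - 1)) := by gcongr
      _ = _ := by linear_combination (2 * N * ((1 + 4 * damping N n) ^ N - 1)) * h3
  · rw [abs_mul, abs_of_pos hp]
    calc _ ≤ p * (C * ((1 + damping N n) ^ (2 * N) - 1)) := by gcongr
      _ = _ := by linear_combination ((1 + damping N n) ^ (2 * N) - 1) * h3

/-! ### Densities off the middle level and the comparison principle -/

theorem driftProd_succ_apply (δ : ℕ → ℝ) (n : ℕ) (x z : Cube N) :
    driftProd N δ (n + 1) x z = 1 / 2 * driftProd N δ n x z +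
      1 / (4 * N) * ∑ i, coef (δ (n + 1)) (flipAt i z) i * driftProd N δ n x (flipAt i z) :=
  vecMul_lazyDriftKernel (δ (n + 1)) (driftProd N δ n x) z

theorem driftProd_nonneg {δ : ℕ → ℝ} (hδ : ∀ i, |δ i| ≤ 1) (n : ℕ) (x z : Cube N) :
    0 ≤ driftProd N δ n x z := by
  induction n generalizing z with
  | zero =>
    simp only [driftProd, compKernel, one_apply]
    split_ifs <;> simp
  | succ n ih =>
    rw [driftProd_succ_apply]
    have : 0 ≤ ∑ i, coef (δ (n + 1)) (flipAt i z) i * driftProd N δ n x (flipAt i z) :=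
      sum_nonneg fun i _ => mul_nonneg (coef_nonneg (hδ _) _ _) (ih _)
    have := ih z
    positivity

theorem sum_driftProd (hN : 0 < N) (δ : ℕ → ℝ) (n : ℕ) (x : Cube N) :
    ∑ z, driftProd N δ n x z = 1 := by
  have hN' : (N : ℝ) ≠ 0 := by exact_mod_cast hN.ne'
  have hQ : ∀ d, lazyDriftKernel N d *ᵥ 1 = 1 := by
    intro d
    ext x
    rw [lazyDriftKernel_mulVec]
    simp only [Pi.one_apply, mul_one, sum_coef]
    field_simp
    norm_num
  have h : driftProd N δ n *ᵥ 1 = 1 := by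
    induction n with
    | zero => simp [driftProd, compKernel]
    | succ n ih => rw [driftProd_succ_mulVec, hQ, ih]
  simpa [mulVec, dotProduct] using congrFun h x

theorem driftProd_zero_eq_pow (n : ℕ) :
    driftProd N (fun _ => 0) n = lazyDriftKernel N 0 ^ n := by
  induction n with
  | zero => rfl
  | succ n ih => rw [pow_succ, ← ih]; rfl

theorem driftProd_density_succ (δ : ℕ → ℝ) (n : ℕ) (x z : Cube N) :
    (4 : ℝ) ^ N * driftProd N δ (n + 1) x z = 1 / 2 * ((4 : ℝ) ^ N * driftProd N δ n x z) +
      1 / (4 * N) * ∑ i, coef (δ (n + 1)) (flipAt i z) i *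
        ((4 : ℝ) ^ N * driftProd N δ n x (flipAt i z)) := by
  have : ∑ i, coef (δ (n + 1)) (flipAt i z) i * ((4 : ℝ) ^ N * driftProd N δ n x (flipAt i z)) =
      4 ^ N * ∑ i, coef (δ (n + 1)) (flipAt i z) i * driftProd N δ n x (flipAt i z) := by
    rw [mul_sum]
    exact sum_congr rfl fun i _ => by ring
  rw [driftProd_succ_apply, this]
  ring

/-- Comparison principle off the middle level, whose values play the role of boundary data. -/
theorem le_of_supersolution (hN : 0 < N) {δ : ℕ → ℝ} {G H : ℕ → Cube N → ℝ}
    (hG : ∀ n z, weight z ≠ N → G (n + 1) z = 1 / 2 * G n z +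
      1 / (4 * N) * ∑ i, coef (δ n) (flipAt i z) i * G n (flipAt i z))
    (hH : ∀ n z, weight z ≠ N →
      1 / 2 * H n z + 1 / (4 * N) * ∑ i, H n (flipAt i z) ≤ H (n + 1) z)
    (hmid : ∀ n y i, weight y = N → coef (δ n) y i * G n y ≤ H n y)
    (h0 : ∀ z, weight z ≠ N → G 0 z ≤ H 0 z) (n : ℕ) :
    ∀ z, weight z ≠ N → G n z ≤ H n z := by
  induction n with
  | zero => exact h0
  | succ n ih =>
    intro z hz
    rw [hG n z hz]
    refine le_trans ?_ (hH n z hz)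
    have hN' : (0 : ℝ) < N := by exact_mod_cast hN
    gcongr with i _
    · exact ih z hz
    · by_cases hw : weight (flipAt i z) = N
      · exact hmid n _ i hw
      · rw [coef_of_weight_ne hw, one_mul]
        exact ih _ hw

/-- The distance of the level of `z` from the middle level. -/
def midDist (z : Cube N) : ℝ := |(weight z : ℝ) - N|

theorem midDist_nonneg (z : Cube N) : 0 ≤ midDist z := abs_nonneg _

theorem midDist_of_weight_eq {z : Cube N} (hz : weight z = N) : midDist z = 0 := by
  simp [midDist, hz]

theorem one_le_midDist {z : Cube N} (hz : weight z ≠ N) : 1 ≤ midDist z := by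
  have h : (1 : ℤ) ≤ |(weight z : ℤ) - N| := Int.one_le_abs (by omega)
  unfold midDist
  exact_mod_cast h

theorem midDist_le (z : Cube N) : midDist z ≤ N := by
  have h : weight z ≤ 2 * N := by
    rw [weight_eq_card]
    simpa using card_le_univ ({i | z i = 1} : Finset (Fin (2 * N)))
  have h' : (weight z : ℝ) ≤ 2 * N := by exact_mod_cast h
  have h0 : (0 : ℝ) ≤ weight z := by positivity
  exact abs_le.2 ⟨by linarith, by linarith⟩

/-- Off the middle level `midDist` is linear in the level up to and including the middle, so it is
an eigenfunction like the level itself. -/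
theorem average_midDist (hN : 0 < N) {z : Cube N} (hz : weight z ≠ N) :
    1 / 2 * midDist z + 1 / (4 * N) * ∑ i, midDist (flipAt i z) =
      (1 - 1 / (2 * N)) * midDist z := by
  have hN' : (N : ℝ) ≠ 0 := by exact_mod_cast hN.ne'
  obtain ⟨s, hs, hs'⟩ : ∃ s : ℝ, |s| = 1 ∧ (weight z : ℝ) - N = s * midDist z := by
    rcases le_total 0 ((weight z : ℝ) - N) with h | h
    · exact ⟨1, by simp, by rw [midDist, abs_of_nonneg h, one_mul]⟩
    · exact ⟨-1, by simp, by rw [midDist, abs_of_nonpos h]; ring⟩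
  have hss : s * s = 1 := by rw [← abs_mul_abs_self, hs, one_mul]
  have h1 : ∀ i, midDist (flipAt i z) = midDist z + s * (1 - 2 * bit z i) := by
    intro i
    have h2 : -1 ≤ s * (1 - 2 * bit z i) := by
      have : |s * (1 - 2 * bit z i)| = 1 := by rw [abs_mul, hs, abs_one_sub_two_mul_bit, one_mul]
      exact (abs_le.1 this.le).1
    have h3 := one_le_midDist hz
    rw [midDist, weight_flipAt,
      show (weight z : ℝ) + (1 - 2 * bit z i) - N = s * (midDist z + s * (1 - 2 * bit z i)) by
        linear_combination hs' - (1 - 2 * bit z i) * hss,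
      abs_mul, hs, one_mul, abs_of_nonneg (by linarith)]
  rw [sum_congr rfl fun i _ => h1 i, sum_add_distrib, ← mul_sum, sum_one_sub_two_mul_bit,
    sum_const, card_univ, Fintype.card_fin, nsmul_eq_mul,
    show (weight z : ℝ) = s * midDist z + N by linarith]
  push_cast
  field_simp
  linear_combination (-4 * midDist z) * hss

/-- The supersolution is the free evolution of the law at time `m`, which is at most 2 after `m`
more steps, plus the constant 4. That constant dominates the boundary data, a `coef` at most 2 times
a density at most 2. -/
theorem driftProd_density_le (hN : 0 < N) {δ : ℕ → ℝ} (hδ : ∀ i, |δ i| ≤ 1) {m : ℕ}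
    (hfree : ∀ n, m ≤ n → ∀ x z : Cube N, (4 : ℝ) ^ N * (lazyDriftKernel N 0 ^ n) x z ≤ 2)
    (hmid : ∀ n, m ≤ n → ∀ x z : Cube N, weight z = N → (4 : ℝ) ^ N * driftProd N δ n x z ≤ 2)
    {n : ℕ} (hn : 2 * m ≤ n) (x z : Cube N) (hz : weight z ≠ N) :
    (4 : ℝ) ^ N * driftProd N δ n x z ≤ 6 := by
  have hN' : (N : ℝ) ≠ 0 := by exact_mod_cast hN.ne'
  set A : ℕ → Cube N → ℝ := fun k z =>
    ∑ y, driftProd N δ m x y * ((4 : ℝ) ^ N * (lazyDriftKernel N 0 ^ k) y z) with hA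
  have hAnn : ∀ k z, 0 ≤ A k z := by
    intro k z
    refine sum_nonneg fun y _ =>
      mul_nonneg (driftProd_nonneg hδ _ _ _) (mul_nonneg (by positivity) ?_)
    rw [← driftProd_zero_eq_pow]
    exact driftProd_nonneg (by simp) _ _ _
  have hAeq : ∀ k, A k = (4 : ℝ) ^ N • (driftProd N δ m x ᵥ* lazyDriftKernel N 0 ^ k) := by
    intro k
    ext z
    simp only [hA, vecMul, dotProduct, Pi.smul_apply, smul_eq_mul, mul_sum]
    exact sum_congr rfl fun y _ => by ring
  have key := le_of_supersolution hN (δ := fun k => δ (m + k + 1))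
    (G := fun k z => (4 : ℝ) ^ N * driftProd N δ (m + k) x z) (H := fun k z => A k z + 4)
    ?_ ?_ ?_ ?_ (n - m) z hz
  · simp only [Nat.add_sub_cancel' (show m ≤ n by omega)] at key
    refine key.trans ?_
    have : A (n - m) z ≤ 2 := by
      calc A (n - m) z ≤ ∑ y, driftProd N δ m x y * 2 :=
            sum_le_sum fun y _ => mul_le_mul_of_nonneg_left (hfree _ (by omega) y z)
              (driftProd_nonneg hδ _ _ _)
        _ = 2 := by rw [← sum_mul, sum_driftProd hN, one_mul]
    linarith
  · intro k z _
    exact driftProd_density_succ δ (m + k) x z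
  · intro k z _
    have h1 : A (k + 1) z = 1 / 2 * A k z + 1 / (4 * N) * ∑ i, A k (flipAt i z) := by
      have h2 : A (k + 1) = A k ᵥ* lazyDriftKernel N 0 := by
        rw [hAeq, hAeq, pow_succ, ← vecMul_vecMul, smul_vecMul]
      rw [h2, vecMul_lazyDriftKernel]
      simp only [coef_zero, one_mul]
    rw [h1, sum_add_distrib, sum_const, card_univ, Fintype.card_fin, nsmul_eq_mul]
    push_cast
    refine le_of_eq ?_
    field_simp
    ring
  · intro k y i hy
    have h1 := hmid (m + k) (by omega) x y hy
    have h2 := abs_le.1 ((abs_coef_sub_one_le (δ (m + k + 1)) y i).trans (hδ _))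
    have h3 : 0 ≤ (4 : ℝ) ^ N * driftProd N δ (m + k) x y :=
      mul_nonneg (by positivity) (driftProd_nonneg hδ _ _ _)
    have h4 := hAnn k y
    have h5 := mul_le_mul_of_nonneg_right (show coef (δ (m + k + 1)) y i ≤ 2 by linarith [h2.2]) h3
    linarith
  · intro z _
    have h1 : A 0 z = (4 : ℝ) ^ N * driftProd N δ m x z := by
      rw [hAeq, pow_zero, vecMul_one]; rfl
    simp only [h1, add_zero]
    linarith

/-- Both densities have boundary values within `e` of 1 and the same `coef`, so the boundary data of
the difference are at most `2 * (2 * e)`. The initial difference, at most 6, is dominated by `6 *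
midDist` and decays. -/
theorem driftProd_density_sub_le (hN : 0 < N) {δ : ℕ → ℝ} (hδ : ∀ i, |δ i| ≤ 1) {m : ℕ} {e : ℝ}
    (hmid : ∀ n, m ≤ n → ∀ x z : Cube N, weight z = N →
      |(4 : ℝ) ^ N * driftProd N δ n x z - 1| ≤ e)
    (hup : ∀ x z : Cube N, weight z ≠ N → (4 : ℝ) ^ N * driftProd N δ m x z ≤ 6)
    (k : ℕ) (x y z : Cube N) (hz : weight z ≠ N) :
    (4 : ℝ) ^ N * driftProd N δ (m + k) x z - (4 : ℝ) ^ N * driftProd N δ (m + k) y z ≤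
      6 * (1 - 1 / (2 * N)) ^ k * midDist z + 4 * e := by
  have hN' : (N : ℝ) ≠ 0 := by exact_mod_cast hN.ne'
  have he : ∀ w : Cube N, weight w = N → 0 ≤ e := fun w hw =>
    (abs_nonneg _).trans (hmid m le_rfl w w hw)
  refine le_of_supersolution hN (δ := fun k => δ (m + k + 1))
    (G := fun k z => (4 : ℝ) ^ N * driftProd N δ (m + k) x z -
      (4 : ℝ) ^ N * driftProd N δ (m + k) y z)
    (H := fun k z => 6 * (1 - 1 / (2 * N)) ^ k * midDist z + 4 * e) ?_ ?_ ?_ ?_ k z hz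
  · intro k z _
    have h1 := driftProd_density_succ δ (m + k) x z
    have h2 := driftProd_density_succ δ (m + k) y z
    have h3 : ∑ i, coef (δ (m + k + 1)) (flipAt i z) i *
        ((4 : ℝ) ^ N * driftProd N δ (m + k) x (flipAt i z) -
          (4 : ℝ) ^ N * driftProd N δ (m + k) y (flipAt i z)) =
        ∑ i, coef (δ (m + k + 1)) (flipAt i z) i *
          ((4 : ℝ) ^ N * driftProd N δ (m + k) x (flipAt i z)) -
        ∑ i, coef (δ (m + k + 1)) (flipAt i z) i *
          ((4 : ℝ) ^ N * driftProd N δ (m + k) y (flipAt i z)) := by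
      rw [← sum_sub_distrib]
      exact sum_congr rfl fun i _ => mul_sub _ _ _
    linear_combination h1 - h2 - 1 / (4 * N) * h3
  · intro k z hz
    refine le_of_eq ?_
    rw [sum_add_distrib, ← mul_sum, sum_const, card_univ, Fintype.card_fin, nsmul_eq_mul, pow_succ]
    push_cast
    have h := average_midDist hN hz
    have h4 : 1 / (4 * (N : ℝ)) * (2 * N * (4 * e)) = 2 * e := by
      field_simp
    rw [mul_add (1 / (4 * (N : ℝ))), h4]
    linear_combination (6 * (1 - 1 / (2 * (N : ℝ))) ^ k) * h
  · intro k w i hw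
    rw [midDist_of_weight_eq hw, mul_zero, zero_add]
    have h1 := abs_le.1 (hmid (m + k) (by omega) x w hw)
    have h2 := abs_le.1 (hmid (m + k) (by omega) y w hw)
    have h3 := abs_le.1 ((abs_coef_sub_one_le (δ (m + k + 1)) w i).trans (hδ _))
    have h5 : (4 : ℝ) ^ N * driftProd N δ (m + k) x w -
      (4 : ℝ) ^ N * driftProd N δ (m + k) y w ≤ 2 * e := by linarith [h1.2, h2.1]
    have h6 := mul_le_mul_of_nonneg_left h5 (coef_nonneg (hδ (m + k + 1)) w i)
    have h7 := mul_le_mul_of_nonneg_right (show coef (δ (m + k + 1)) w i ≤ 2 by linarith [h3.2])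
      (he w hw)
    linarith
  · intro z hz
    have h1 := hup x z hz
    have h2 : 0 ≤ (4 : ℝ) ^ N * driftProd N δ m y z :=
      mul_nonneg (by positivity) (driftProd_nonneg hδ _ _ _)
    have h3 := one_le_midDist hz
    -- A middle vertex is produced only to know that `e` is nonnegative.
    obtain ⟨w, hw⟩ : ∃ w : Cube N, weight w = N := by
      have : 0 < #{x : Cube N | weight x = N} := by
        rw [card_middle]; exact Nat.choose_pos (by omega)
      obtain ⟨w, hw⟩ := card_pos.1 this
      exact ⟨w, by simpa using hw⟩
    have h4 := he w hw
    simp only [add_zero, pow_zero, mul_one]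
    linarith

/-- The middle level emits boundary data at least `(1 - ε) * (1 / 2)`. This is the only lower bound
in which `ε < 1` will matter. Comparison is applied to the negated density. -/
theorem le_driftProd_density (hN : 0 < N) {ε : ℝ} (hε : ε ≤ 1) {δ : ℕ → ℝ} (hδ : ∀ i, |δ i| ≤ ε)
    {m : ℕ}
    (hmid : ∀ n, m ≤ n → ∀ x z : Cube N, weight z = N →
      1 / 2 ≤ (4 : ℝ) ^ N * driftProd N δ n x z)
    (k : ℕ) (x z : Cube N) (hz : weight z ≠ N) :
    (1 - ε) / 2 * (1 - (1 - 1 / (2 * N)) ^ k * midDist z) ≤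
      (4 : ℝ) ^ N * driftProd N δ (m + k) x z := by
  have hN' : (N : ℝ) ≠ 0 := by exact_mod_cast hN.ne'
  have hδ1 : ∀ i, |δ i| ≤ 1 := fun i => (hδ i).trans hε
  have key := le_of_supersolution hN (δ := fun k => δ (m + k + 1))
    (G := fun k z => -((4 : ℝ) ^ N * driftProd N δ (m + k) x z))
    (H := fun k z => (1 - ε) / 2 * (1 - 1 / (2 * N)) ^ k * midDist z + -((1 - ε) / 2))
    ?_ ?_ ?_ ?_ k z hz
  · linarith
  · intro k z _
    have h1 := driftProd_density_succ δ (m + k) x z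
    have h3 : ∑ i, coef (δ (m + k + 1)) (flipAt i z) i *
        -((4 : ℝ) ^ N * driftProd N δ (m + k) x (flipAt i z)) =
        -∑ i, coef (δ (m + k + 1)) (flipAt i z) i *
          ((4 : ℝ) ^ N * driftProd N δ (m + k) x (flipAt i z)) := by
      rw [← sum_neg_distrib]
      exact sum_congr rfl fun i _ => mul_neg _ _
    linear_combination -h1 - 1 / (4 * N) * h3
  · intro k z hz
    refine le_of_eq ?_
    rw [sum_add_distrib, ← mul_sum, sum_const, card_univ, Fintype.card_fin, nsmul_eq_mul, pow_succ]
    push_cast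
    have h := average_midDist hN hz
    have h4 : 1 / (4 * (N : ℝ)) * (2 * N * (-((1 - ε) / 2))) = -((1 - ε) / 4) := by
      field_simp
    rw [mul_add (1 / (4 * (N : ℝ))), h4]
    linear_combination ((1 - ε) / 2 * (1 - 1 / (2 * (N : ℝ))) ^ k) * h
  · intro k w i hw
    rw [midDist_of_weight_eq hw, mul_zero, zero_add]
    have h1 := hmid (m + k) (by omega) x w hw
    have h3 := abs_le.1 ((abs_coef_sub_one_le (δ (m + k + 1)) w i).trans (hδ _))
    have h4 := mul_le_mul (show 1 - ε ≤ coef (δ (m + k + 1)) w i by linarith [h3.1]) h1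
      (by norm_num) (coef_nonneg (hδ1 _) w i)
    linarith
  · intro z hz
    have h2 : 0 ≤ (4 : ℝ) ^ N * driftProd N δ m x z :=
      mul_nonneg (by positivity) (driftProd_nonneg hδ1 _ _ _)
    have h3 := mul_le_mul_of_nonneg_left (one_le_midDist hz)
      (show 0 ≤ (1 - ε) / 2 by linarith)
    simp only [add_zero, pow_zero, mul_one]
    linarith

/-! ### Quantitative relative merging -/

theorem damping_antitone : Antitone (damping N) := by
  intro m n hmn
  unfold damping
  have : (m : ℝ) ≤ n := by exact_mod_cast hmn
  gcongr

theorem one_add_pow_sub_one_le {t : ℝ} (ht : 0 ≤ t) (k : ℕ) (h : k * t ≤ 1) :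
    (1 + t) ^ k - 1 ≤ 2 * (k * t) := by
  have h0 : 0 ≤ k * t := by positivity
  have h1 : (1 + t) ^ k ≤ Real.exp (k * t) := by
    rw [Real.exp_nat_mul]
    refine pow_le_pow_left₀ (by linarith) ?_ k
    linarith [Real.add_one_le_exp t]
  have h2 := Real.abs_exp_sub_one_le (x := k * t) (by rwa [abs_of_nonneg h0])
  rw [abs_of_nonneg h0] at h2
  linarith [le_abs_self (Real.exp (k * t) - 1)]

/-- Three time blocks of length `m`: after the first the middle level is equidistributed, after the
second the density is bounded, and during the third the initial data off the middle level are
forgotten. With `s = N² θ`, the bound `s ≤ 1 / 40` makes the middle error `20 * s` at most `1 / 2`.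
-/
theorem driftProd_pos_and_abs_sub_le (hN : 0 < N) {ε : ℝ} (hε : ε < 1) {δ : ℕ → ℝ}
    (hδ : ∀ i, |δ i| ≤ ε) {m : ℕ} (hm : (N : ℝ) ^ 2 * damping N m ≤ 1 / 40) {n : ℕ}
    (hn : 3 * m ≤ n) (x y z : Cube N) :
    0 < driftProd N δ n y z ∧ |driftProd N δ n x z - driftProd N δ n y z| ≤
      344 / (1 - ε) * ((N : ℝ) ^ 2 * damping N m) * driftProd N δ n y z := by
  have hδ1 : ∀ i, |δ i| ≤ 1 := fun i => (hδ i).trans hε.le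
  have hε0 : 0 < 1 - ε := by linarith
  have hN1 : (1 : ℝ) ≤ N := by exact_mod_cast hN
  set θ := damping N m with hθ
  have hθ0 : 0 < θ := damping_pos N m
  set s := (N : ℝ) ^ 2 * θ with hs
  have hNθ : (N : ℝ) * θ ≤ s := by
    rw [hs, sq]
    exact mul_le_mul_of_nonneg_right (le_mul_of_one_le_left (by linarith) hN1) hθ0.le
  have hNθ0 : 0 ≤ (N : ℝ) * θ := by positivity
  have hfreeN : (1 + θ) ^ (2 * N) - 1 ≤ 4 * s := by
    have := one_add_pow_sub_one_le hθ0.le (2 * N) (by push_cast; linarith)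
    push_cast at this
    linarith
  have hslice : 2 * N * ((1 + 4 * θ) ^ N - 1) ≤ 16 * s := by
    have h1 := one_add_pow_sub_one_le (t := 4 * θ) (by linarith) N (by linarith)
    calc 2 * N * ((1 + 4 * θ) ^ N - 1) ≤ 2 * N * (2 * (N * (4 * θ))) := by gcongr
      _ = 16 * s := by rw [hs]; ring
  have hfree : ∀ k, m ≤ k → ∀ x z : Cube N, (4 : ℝ) ^ N * (lazyDriftKernel N 0 ^ k) x z ≤ 2 := by
    intro k hk x z
    have h1 := (abs_le.1 (abs_pow_lazyDriftKernel_zero_sub_le hN k x z)).2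
    have h2 : (1 + damping N k) ^ (2 * N) ≤ (1 + θ) ^ (2 * N) := by
      have := damping_pos N k
      have := damping_antitone (N := N) hk
      gcongr
    linarith
  have hmid : ∀ k, m ≤ k → ∀ x z : Cube N, weight z = N →
      |(4 : ℝ) ^ N * driftProd N δ k x z - 1| ≤ 20 * s := by
    intro k hk x z hz
    refine (abs_driftProd_mid_sub_one_le hN hδ1 k x hz).trans ?_
    have h0 := damping_pos N k
    have h1 : damping N k ≤ θ := damping_antitone hk
    have h2 : (1 + damping N k) ^ (2 * N) ≤ (1 + θ) ^ (2 * N) := by gcongr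
    have h3 : 2 * N * ((1 + 4 * damping N k) ^ N - 1) ≤ 2 * N * ((1 + 4 * θ) ^ N - 1) := by gcongr
    linarith
  have hmid1 : ∀ k, m ≤ k → ∀ x z : Cube N, weight z = N →
      1 / 2 ≤ (4 : ℝ) ^ N * driftProd N δ k x z := by
    intro k hk x z hz
    have := (abs_le.1 (hmid k hk x z hz)).1
    linarith
  have hup : ∀ x z : Cube N, weight z ≠ N → (4 : ℝ) ^ N * driftProd N δ (2 * m) x z ≤ 6 := by
    refine fun x z hz => driftProd_density_le hN hδ1 hfree (fun k hk x z hz => ?_) le_rfl x z hz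
    have := (abs_le.1 (hmid k hk x z hz)).2
    linarith
  obtain ⟨k, rfl⟩ : ∃ k, n = 2 * m + k := ⟨n - 2 * m, by omega⟩
  have hρ0 : (0 : ℝ) ≤ 1 - 1 / (2 * N) := by
    have : 1 / (2 * (N : ℝ)) ≤ 1 := (div_le_one (by linarith)).2 (by linarith)
    linarith
  have hρ : (1 - 1 / (2 * (N : ℝ))) ^ k ≤ θ := by
    have h1 := pow_le_damping_pow (N := N) (j := 1) (by omega) k
    rw [Nat.cast_one, pow_one] at h1
    exact h1.trans (damping_antitone (by omega))
  have hdist : (1 - 1 / (2 * (N : ℝ))) ^ k * midDist z ≤ s := by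
    calc _ ≤ θ * N := mul_le_mul hρ (midDist_le z) (midDist_nonneg z) hθ0.le
      _ ≤ s := by linarith
  have hP : (0 : ℝ) < 4 ^ N := by positivity
  have hlow : ∀ y, (1 - ε) / 4 ≤ (4 : ℝ) ^ N * driftProd N δ (2 * m + k) y z := by
    intro y
    have hεn : 0 ≤ ε := (abs_nonneg _).trans (hδ 0)
    by_cases hz : weight z = N
    · have := hmid1 (2 * m + k) (by omega) y z hz
      linarith
    · refine le_trans ?_ (le_driftProd_density hN hε.le hδ
        (fun k hk => hmid1 k (by omega)) k y z hz)
      have h1 := mul_le_mul_of_nonneg_left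
        (show 1 / 2 ≤ 1 - (1 - 1 / (2 * (N : ℝ))) ^ k * midDist z by linarith)
        (show 0 ≤ (1 - ε) / 2 by linarith)
      linarith
  -- Off the middle level, `86 = 6 + 4 * 20`. Dividing by the lower bound `(1 - ε) / 4` then gives
  -- `344 / (1 - ε)`.
  have hdiff : |(4 : ℝ) ^ N * driftProd N δ (2 * m + k) x z -
      (4 : ℝ) ^ N * driftProd N δ (2 * m + k) y z| ≤ 86 * s := by
    by_cases hz : weight z = N
    · have h1 := abs_le.1 (hmid (2 * m + k) (by omega) x z hz)
      have h2 := abs_le.1 (hmid (2 * m + k) (by omega) y z hz)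
      exact abs_le.2 ⟨by linarith [h1.1, h2.2], by linarith [h1.2, h2.1]⟩
    · have h1 := driftProd_density_sub_le hN hδ1 (fun k hk => hmid k (by omega)) hup k x y z hz
      have h2 := driftProd_density_sub_le hN hδ1 (fun k hk => hmid k (by omega)) hup k y x z hz
      exact abs_le.2 ⟨by linarith, by linarith⟩
  have hy := hlow y
  refine ⟨pos_of_mul_pos_right (by linarith : 0 < (4 : ℝ) ^ N * _) hP.le, ?_⟩
  rw [← mul_sub, abs_mul, abs_of_pos hP] at hdiff
  refine le_of_mul_le_mul_left (hdiff.trans ?_) hP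
  have hc : 0 ≤ 344 / (1 - ε) * s := by positivity
  calc 86 * s = 344 / (1 - ε) * s * ((1 - ε) / 4) := by
        field_simp
        ring
    _ ≤ 344 / (1 - ε) * s * (4 ^ N * driftProd N δ (2 * m + k) y z) := by gcongr
    _ = _ := by ring

theorem exp_neg_posLog_le {η : ℝ} (hη : 0 < η) :
    Real.exp (-Real.posLog (1 / η)) ≤ η := by
  have h : -Real.log η ≤ Real.posLog (1 / η) := by
    rw [← Real.log_inv, ← one_div]
    exact le_max_right _ _
  calc Real.exp (-Real.posLog (1 / η)) ≤ Real.exp (Real.log η) := by gcongr; linarith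
    _ = η := Real.exp_log hη

theorem half_le_log {N : ℕ} (hN : 2 ≤ N) : 1 / 2 ≤ Real.log N := by
  have h1 : Real.log 2 ≤ Real.log N :=
    Real.log_le_log (by norm_num) (by exact_mod_cast hN)
  linarith [Real.log_two_gt_d9]

theorem exists_relative_merging {ε : ℝ} (hε0 : 0 < ε) (hε : ε < 1) :
    ∃ D : ℝ, 0 < D ∧ ∀ N : ℕ, 2 ≤ N → ∀ δ : ℕ → ℝ, (∀ i, |δ i| ≤ ε) → ∀ η : ℝ, 0 < η →
      ∀ n : ℕ, D * N * (Real.log N + Real.posLog (1 / η)) ≤ n → ∀ x y z : Cube N,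
        0 < driftProd N δ n y z ∧ |driftProd N δ n x z - driftProd N δ n y z| ≤
          η * driftProd N δ n y z := by
  have hε1 : 0 < 1 - ε := by linarith
  have hc : 1 ≤ 344 / (1 - ε) := by
    rw [le_div_iff₀ hε1]; linarith
  set a := Real.log (344 / (1 - ε)) with ha
  have ha0 : 0 ≤ a := Real.log_nonneg hc
  refine ⟨12 * (2 + a), by linarith, fun N hN δ hδ η hη n hn x y z => ?_⟩
  have hN2 : (2 : ℝ) ≤ N := by exact_mod_cast hN
  have hlog := half_le_log hN
  set L := Real.posLog (1 / η) with hL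
  have hL0 : 0 ≤ L := Real.posLog_nonneg
  set m := n / 3 with hm
  have hm3 : (n : ℝ) ≤ 3 * m + 2 := by
    have : n ≤ 3 * m + 2 := by omega
    exact_mod_cast this
  have hexp : 2 * Real.log N + a + L ≤ m / (2 * N) := by
    rw [le_div_iff₀ (by linarith)]
    -- The term `a` and the spare 1, which pays for rounding in `n / 3`, are absorbed using `1 / 2 ≤
    -- log N`.
    have h1 : 2 * Real.log N + a + L + 1 ≤ 2 * (2 + a) * (Real.log N + L) := by
      have h2 := mul_nonneg ha0 hL0
      have h3 := mul_nonneg ha0 (sub_nonneg.2 hlog)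
      linarith
    have h4 := mul_le_mul_of_nonneg_right h1 (by linarith : (0 : ℝ) ≤ 6 * N)
    have h5 : 12 * (2 + a) * N * (Real.log N + L) ≤ 3 * m + 2 := hn.trans hm3
    linarith
  have hkey : 344 / (1 - ε) * ((N : ℝ) ^ 2 * damping N m) ≤ Real.exp (-L) := by
    have h1 : 344 / (1 - ε) = Real.exp a := (Real.exp_log (by linarith)).symm
    have h2 : (N : ℝ) ^ 2 = Real.exp (2 * Real.log N) := by
      rw [two_mul, Real.exp_add, Real.exp_log (by linarith), sq]
    rw [h1, h2, damping, ← Real.exp_add, ← Real.exp_add, Real.exp_le_exp, neg_div]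
    linarith
  have hle1 : Real.exp (-L) ≤ 1 := Real.exp_le_one_iff.2 (by linarith)
  have h344 : 344 ≤ 344 / (1 - ε) := by
    rw [le_div_iff₀ hε1]; linarith
  have hs : (N : ℝ) ^ 2 * damping N m ≤ 1 / 40 := by
    have h0 : 0 ≤ (N : ℝ) ^ 2 * damping N m := mul_nonneg (by positivity) (damping_pos N m).le
    have := mul_le_mul_of_nonneg_right h344 h0
    linarith
  obtain ⟨h1, h2⟩ := driftProd_pos_and_abs_sub_le (by omega) hε hδ hs (show 3 * m ≤ n by omega)
    x y z
  exact ⟨h1, h2.trans (mul_le_mul_of_nonneg_right (hkey.trans (exp_neg_posLog_le hη)) h1.le)⟩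

/-! ### Transfer to the merging time and the relative deviation -/

theorem compKernel_congr {V : Type*} [Fintype V] [DecidableEq V] {K K' : ℕ → Matrix V V ℝ}
    (h : ∀ i, 1 ≤ i → K i = K' i) (n : ℕ) : compKernel K n = compKernel K' n := by
  induction n with
  | zero => rfl
  | succ n ih => rw [compKernel, compKernel, ih, h (n + 1) (by omega)]

theorem exists_drift_of_mem_lazyFamily {ε : ℝ} (hε : 0 ≤ ε)
    {K : ℕ → Matrix (Cube N) (Cube N) ℝ} (hK : ∀ i, 1 ≤ i → K i ∈ lazyFamily N ε) :
    ∃ δ : ℕ → ℝ, (∀ i, |δ i| ≤ ε) ∧ ∀ n, compKernel K n = driftProd N δ n := by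
  have h : ∀ i, ∃ d : ℝ, |d| ≤ ε ∧ (1 ≤ i → K i = lazyDriftKernel N d) := by
    intro i
    by_cases hi : 1 ≤ i
    · obtain ⟨d, hd, hdK⟩ := hK i hi
      exact ⟨d, abs_le.2 hd, fun _ => hdK.symm⟩
    -- Index 0 is unconstrained and never enters the product, so any admissible drift serves there.
    · exact ⟨0, by simpa using hε, fun h => absurd h hi⟩
  choose δ hδ hδK using h
  exact ⟨δ, hδ, compKernel_congr hδK⟩

section General

variable {V : Type*} [Fintype V] [DecidableEq V]

theorem maxRelDev_le {K : ℕ → Matrix V V ℝ} {n : ℕ} {η : ℝ}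
    (h : ∀ x y z, 0 < compKernel K n y z ∧
      |compKernel K n x z - compKernel K n y z| ≤ η * compKernel K n y z) :
    maxRelDev K n ≤ ENNReal.ofReal η := by
  refine iSup_le fun x => iSup_le fun y => iSup_le fun z => ?_
  obtain ⟨hpos, hle⟩ := h x y z
  rw [relDev, if_neg hpos.ne', div_sub_one hpos.ne', abs_div, abs_of_pos hpos]
  exact ENNReal.ofReal_le_ofReal ((div_le_iff₀ hpos).2 hle)

theorem maxTV_le [Nonempty V] {K : ℕ → Matrix V V ℝ} {n : ℕ} {η : ℝ} (hη : 0 ≤ η)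
    (hsum : ∀ y, ∑ z, compKernel K n y z = 1)
    (h : ∀ x y z, 0 < compKernel K n y z ∧
      |compKernel K n x z - compKernel K n y z| ≤ η * compKernel K n y z) :
    maxTV K n ≤ η := by
  refine ciSup_le fun p => ciSup_le fun A => ?_
  rw [← sum_sub_distrib]
  calc ∑ z ∈ A, (compKernel K n p.1 z - compKernel K n p.2 z)
      ≤ ∑ z ∈ A, η * compKernel K n p.2 z :=
        sum_le_sum fun z _ => (le_abs_self _).trans (h _ _ _).2
    _ ≤ ∑ z, η * compKernel K n p.2 z :=
        sum_le_sum_of_subset_of_nonneg (subset_univ A)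
          fun z _ _ => mul_nonneg hη (h p.1 p.2 z).1.le
    _ = η := by rw [← mul_sum, hsum, mul_one]

theorem tvMergingTime_le {K : ℕ → Matrix V V ℝ} {n : ℕ} {η t : ℝ} (h : maxTV K n < η)
    (hn : (n : ℝ) ≤ t) : ((tvMergingTime K η : ℕ∞) : ENNReal) ≤ ENNReal.ofReal t := by
  have h1 : tvMergingTime K η ≤ n := iInf₂_le n h
  calc ((tvMergingTime K η : ℕ∞) : ENNReal) ≤ ((n : ℕ∞) : ENNReal) := ENat.toENNReal_le.2 h1
    _ = ENNReal.ofReal n := by rw [ENat.toENNReal_coe, ENNReal.ofReal_natCast]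
    _ ≤ ENNReal.ofReal t := ENNReal.ofReal_le_ofReal hn

end General

end InhomMerging

theorem theorem4p5 (ε : ℝ) (hε : ε ∈ Set.Ioo (0 : ℝ) 1) :
    ∃ D : ℝ, 0 < D ∧
      ∀ (N : ℕ), 2 ≤ N →
      ∀ K : ℕ → Matrix (InhomMerging.Cube N) (InhomMerging.Cube N) ℝ,
        (∀ i : ℕ, 1 ≤ i → K i ∈ InhomMerging.lazyFamily N ε) →
      ∀ η : ℝ, 0 < η →
        ((InhomMerging.tvMergingTime K η : ℕ∞) : ENNReal) ≤
            ENNReal.ofReal (D * N * (Real.log N + Real.posLog (1 / η))) ∧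
        ∀ n : ℕ, D * N * (Real.log N + Real.posLog (1 / η)) ≤ (n : ℝ) →
          InhomMerging.maxRelDev K n ≤ ENNReal.ofReal η := by
  obtain ⟨D, hD, hmerge⟩ := InhomMerging.exists_relative_merging hε.1 hε.2
  -- The merging time needs a strict inequality, so merging is applied with `η / 2`. The extra `log
  -- 2` is at most `log N`, which doubles `D`, and rounding the time up costs at most `1 ≤ N * (log
  -- N + log₊ (1 / η))`.
  refine ⟨2 * D + 1, by linarith, fun N hN K hK η hη => ?_⟩
  obtain ⟨δ, hδ, hKδ⟩ := InhomMerging.exists_drift_of_mem_lazyFamily hε.1.le hK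
  have hN2 : (2 : ℝ) ≤ N := by exact_mod_cast hN
  have hlog := InhomMerging.half_le_log hN
  have hL0 : 0 ≤ Real.posLog (1 / η) := Real.posLog_nonneg
  have hNS : 1 ≤ N * (Real.log N + Real.posLog (1 / η)) := by
    have := mul_le_mul hN2 (show 1 / 2 ≤ Real.log N + Real.posLog (1 / η) by linarith)
      (by norm_num) (by linarith)
    linarith
  have hDNS := mul_le_mul_of_nonneg_left hNS hD.le
  constructor
  · have hL : Real.posLog (1 / (η / 2)) ≤ Real.log N + Real.posLog (1 / η) := by
      have h1 : Real.posLog 2 ≤ Real.log N := by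
        rw [Real.posLog_eq_log (by norm_num)]
        exact Real.log_le_log (by norm_num) hN2
      calc Real.posLog (1 / (η / 2)) = Real.posLog (2 * (1 / η)) := by
            congr 1
            field_simp
        _ ≤ Real.posLog 2 + Real.posLog (1 / η) := Real.posLog_mul
        _ ≤ _ := by linarith
    set t := D * N * (Real.log N + Real.posLog (1 / (η / 2)))
    have ht0 : 0 ≤ t :=
      mul_nonneg (by positivity) (add_nonneg (by linarith) Real.posLog_nonneg)
    have ht : t ≤ D * N * (2 * (Real.log N + Real.posLog (1 / η))) :=
      mul_le_mul_of_nonneg_left (by linarith) (by positivity)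
    refine InhomMerging.tvMergingTime_le (n := ⌈t⌉₊) ?_ ?_
    · refine lt_of_le_of_lt (InhomMerging.maxTV_le (η := η / 2) (by linarith) ?_ ?_)
        (by linarith)
      · rw [hKδ]
        exact InhomMerging.sum_driftProd (by omega) δ _
      · rw [hKδ]
        exact hmerge N hN δ hδ (η / 2) (by linarith) _ (Nat.le_ceil t)
    · have := (Nat.ceil_lt_add_one ht0).le
      linarith
  · intro n hn
    refine InhomMerging.maxRelDev_le ?_
    rw [hKδ]
    exact hmerge N hN δ hδ η hη n (by linarith)
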